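/- **Setting.** Let $n\ge 1$, $\alpha>0$, $\Gamma_+=\{\kappa\in\mathbb R^n:\kappa_i>0 \text{ for all } i\}$, and let $f:\Gamma_+\to(0,\infty)$ be smooth, symmetric, homogeneous of degree one, with $\partial f/\partial\kappa_i>0$ for every $i$; $f$ is extended continuously to $\overline{\Gamma_+}$. Consider the motion of hypersurfaces $M_t=\partial\Omega_t$ in $\mathbb R^{n+1}=\mathbb R^n\times\mathbb R$ with inward normal speed $S=f(\kappa)^\alpha$, where $\kappa=(\kappa_1,\dots,\kappa_n)$ are the principal curvatures. A *smooth subsolution* (resp. *supersolution*) on $[a,b]$, $a<b$, is a family $(\Omega(t))_{t\in[a,b]}$ of closed sets with smooth boundary depending smoothly on $t$, whose boundaries have principal curvatures $\kappa\in\Gamma_+$ and inward normal velocity at least (resp. at most) $f(\kappa)^\alpha$ at every point. A family $(\Omega_t)_{0\le t<T}$ of subsets of $\mathbb R^{n+1}$ is a *barrier solution* if for every $[a,b]\subset[0,T)$ and every $t\in[a,b]$: $\Omega(a)\subseteq\Omega_a$ implies $\Omega(t)\subseteq\Omega_t$ for each smooth subsolution $\Omega(\cdot)$ on $[a,b]$,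 and $\Omega_a\subseteq\Omega(a)$ implies $\Omega_t\subseteq\Omega(t)$ for each smooth supersolution $\Omega(\cdot)$ on $[a,b]$. Write $B_r$ for the open ball of radius $r$ about $0$ in $\mathbb R^n$ and $\overline B_r$ for the closed one ($\overline B_0=\{0\}$, $B_0=\emptyset$). Put $\hat f(x)=f(x,1,\dots,1)$ and $g(x)=\hat f(x)^\alpha-\hat f(0)^\alpha$ for $x\ge0$; $g$ is strictly increasing, and $g^{-1}(z)=\infty$ (so $1/g^{-1}(z)=0$) for $z$ above its range. Let $r(t)=\bigl(1-(1+\alpha)\hat f(0)^\alpha t\bigr)^{1/(1+\alpha)}$, and suppose $$\int_0^1\frac{dz}{g^{-1}(z)}<\infty .$$ **(1)** There is $\tau>0$, depending only on $n,f,\alpha$, with $(1+\alpha)\hat f(0)^\alpha\tau<1$, such that if $L>2$, $T>0$ and $(\Omega_t)_{0\le t<T}$ is any barrier solution with $\Omega_0$ bounded and $B_1\times(-L,L)\subseteq\Omega_0\subseteq\overline B_1\times\mathbb R$, then $$B_{r(t)}\times(-(L-2),L-2)\subseteq\Omega_t\subseteq\overline B_{r(t)}\times\mathbb R\qquad\text{for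 all }t\in[0,\tau]\cap[0,T).$$ **(2)** Suppose in addition that $\hat f(0)>0$, and let $t_*=1/\bigl((1+\alpha)\hat f(0)^\alpha\bigr)$. There is $C>0$, depending only on $n,f,\alpha$, such that if $L>C$, $T>0$ and $(\Omega_t)_{0\le t<T}$ is any barrier solution with $\Omega_0$ bounded and $B_1\times(-L,L)\subseteq\Omega_0\subseteq\overline B_1\times\mathbb R$, then: (a) $\{0\}\times[-(L-C),L-C]\subseteq\Omega_t\subseteq\overline B_{r(t)}\times\mathbb R$ for all $t\in[0,T)$ with $t<t_*$; (b) if $\Omega_t$ has nonempty interior for all $t\in[0,T)$, then $T\le t_*$; (c) if $T\le t_*$, then $\partial\Omega_t$ does not converge to a point as $t\to T$; (d) if $t_*\le T$ and $\Omega_t$ is convex for all $t\in[0,t_*)$, then $\partial\Omega_t$ converges in Hausdorff distance, as $t\uparrow t_*$, to a segment $\{0\}\times[c,d]$ with $c\le-(L-C)$ and $d\ge L-C$. **(3)** For $n\ge2$ and every $\alpha>0$ the function $f(\kappa)=\bigl(\sum_i\kappa_i^2\bigr)^{1/2}$ (speed $|A|^\alpha$) satisfies all the above hypotheses on $f$,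 including $\int_0^1 dz/g^{-1}(z)<\infty$ and $\hat f(0)>0$. -/

import Mathlib

open Set Filter Topology MeasureTheory
open scoped ContDiff ENNReal

noncomputable section

/-- The space `ℝⁿ⁺¹ = ℝⁿ × ℝ`; the last coordinate is the axial coordinate. -/
abbrev AmbientSpace (n : ℕ) : Type := EuclideanSpace ℝ (Fin (n + 1))

/-- The open positive cone `Γ₊` in `ℝⁿ`. -/
def positiveCone (n : ℕ) : Set (Fin n → ℝ) := {κ | ∀ i, 0 < κ i}

/-- Speed functions: smooth, symmetric, strictly increasing in each argument, homogeneous of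
degree one and positive on the positive cone. No normalization of `f (1, …, 1)` is required.
Only the values of `f` on the positive cone matter. -/
structure IsSpeedFunction {n : ℕ} (f : (Fin n → ℝ) → ℝ) : Prop where
  smooth : ContDiffOn ℝ ∞ f (positiveCone n)
  symmetric : ∀ (σ : Equiv.Perm (Fin n)), ∀ κ ∈ positiveCone n, f (κ ∘ σ) = f κ
  increasing : ∀ κ ∈ positiveCone n, ∀ i, 0 < fderiv ℝ f κ (Pi.single i 1)
  homogeneous : ∀ c : ℝ, 0 < c → ∀ κ ∈ positiveCone n, f (c • κ) = c * f κ
  pos : ∀ κ ∈ positiveCone n, 0 < f κ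

/-- `f̂ x = f (x, 1, …, 1)` for `x ≥ 0`, where `f` is extended by continuity from the positive
cone to its closure (this is what gives the value at `x = 0`). -/
def fHat {n : ℕ} [NeZero n] (f : (Fin n → ℝ) → ℝ) (x : ℝ) : ℝ :=
  extendFrom (positiveCone n) f (Function.update (fun _ => 1) 0 x)

/-- `g x = f̂(x)^α - f̂(0)^α`. -/
def gFun {n : ℕ} [NeZero n] (f : (Fin n → ℝ) → ℝ) (α x : ℝ) : ℝ :=
  fHat f x ^ α - fHat f 0 ^ α

/-- The inverse `g⁻¹(z)` of the increasing function `g : [0, ∞) → [0, sup g)`, with the value `∞`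
at those `z` that lie above the range of `g`. -/
def gInv {n : ℕ} [NeZero n] (f : (Fin n → ℝ) → ℝ) (α z : ℝ) : ℝ≥0∞ :=
  ⨅ (x : ℝ) (_ : 0 ≤ x ∧ z ≤ gFun f α x), ENNReal.ofReal x

/-- The condition `∫₀¹ dz / g⁻¹(z) < ∞`. -/
def CylindricalDegeneracy {n : ℕ} [NeZero n] (f : (Fin n → ℝ) → ℝ) (α : ℝ) : Prop :=
  ∫⁻ z in Ioo (0 : ℝ) 1, (gInv f α z)⁻¹ < ⊤

/-- `κ` lists the principal curvatures at `x` of the level set of `φ` through `x`, with respect to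
the unit normal `∇φ / |∇φ|`: in a suitable orthonormal basis of the tangent space `(∇φ x)^⊥` the
second fundamental form `D²φ / |∇φ|` is diagonal with entries `κ`. The list is unique up to order.
With this sign the boundary of a convex region `{φ ≤ 0}` has nonnegative curvatures. -/
def IsPrincipalCurvatures {n : ℕ} (φ : AmbientSpace n → ℝ) (x : AmbientSpace n)
    (κ : Fin n → ℝ) : Prop :=
  ∃ e : Fin n → AmbientSpace n, Orthonormal ℝ e ∧
    (∀ i, inner ℝ (gradient φ x) (e i) = 0) ∧
    ∀ i j, fderiv ℝ (fderiv ℝ φ) x (e i) (e j) = if i = j then ‖gradient φ x‖ * κ i else 0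

/-- `φ` is a smooth defining function on the time interval `[a, b]` for the family `Ω` of closed
sets: `Ω t = {φ t ≤ 0}` and the spatial gradient of `φ` does not vanish on the boundary
`{φ t = 0}`. So each `Ω t` is a closed set with smooth boundary depending smoothly on `t`. -/
structure IsSmoothFamily {n : ℕ} (a b : ℝ) (φ : ℝ → AmbientSpace n → ℝ)
    (Ω : ℝ → Set (AmbientSpace n)) : Prop where
  smooth : ContDiffOn ℝ ∞ (fun p : ℝ × AmbientSpace n => φ p.1 p.2) (Icc a b ×ˢ univ)
  regular : ∀ t ∈ Icc a b, ∀ x, φ t x = 0 → gradient (φ t) x ≠ 0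
  eq_sublevel : ∀ t ∈ Icc a b, Ω t = {x | φ t x ≤ 0}

/-- The velocity, in the direction of the inward normal, of the moving boundary `{φ t = 0}` of
`{φ t ≤ 0}` at time `t ∈ [a, b]` and position `x`. -/
def inwardVelocity {n : ℕ} (a b : ℝ) (φ : ℝ → AmbientSpace n → ℝ) (t : ℝ)
    (x : AmbientSpace n) : ℝ :=
  derivWithin (fun s => φ s x) (Icc a b) t / ‖gradient (φ t) x‖

/-- Smooth subsolutions on `[a, b]` of the flow with inward normal speed `f(κ)^α`: the principal
curvatures of the boundary lie in the positive cone and the inward normal velocity is at least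
`f(κ)^α`. -/
def IsSmoothSubsolution {n : ℕ} (f : (Fin n → ℝ) → ℝ) (α a b : ℝ)
    (Ω : ℝ → Set (AmbientSpace n)) : Prop :=
  ∃ φ : ℝ → AmbientSpace n → ℝ, IsSmoothFamily a b φ Ω ∧
    ∀ t ∈ Icc a b, ∀ x, φ t x = 0 →
      ∃ κ ∈ positiveCone n, IsPrincipalCurvatures (φ t) x κ ∧
        f κ ^ α ≤ inwardVelocity a b φ t x

/-- Smooth supersolutions on `[a, b]`: the inward normal velocity is at most `f(κ)^α`. -/
def IsSmoothSupersolution {n : ℕ} (f : (Fin n → ℝ) → ℝ) (α a b : ℝ)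
    (Ω : ℝ → Set (AmbientSpace n)) : Prop :=
  ∃ φ : ℝ → AmbientSpace n → ℝ, IsSmoothFamily a b φ Ω ∧
    ∀ t ∈ Icc a b, ∀ x, φ t x = 0 →
      ∃ κ ∈ positiveCone n, IsPrincipalCurvatures (φ t) x κ ∧
        inwardVelocity a b φ t x ≤ f κ ^ α

/-- Outer barriers on the time interval `I`; a subset of `ℝⁿ⁺¹ × I` is given by its slices. -/
def IsOuterBarrier {n : ℕ} (f : (Fin n → ℝ) → ℝ) (α : ℝ) (I : Set ℝ)
    (A : ℝ → Set (AmbientSpace n)) : Prop :=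
  ∀ (a b : ℝ) (Ω : ℝ → Set (AmbientSpace n)), a < b → Icc a b ⊆ I →
    IsSmoothSubsolution f α a b Ω → Ω a ⊆ A a → ∀ t ∈ Icc a b, Ω t ⊆ A t

/-- Inner barriers on the time interval `I`. -/
def IsInnerBarrier {n : ℕ} (f : (Fin n → ℝ) → ℝ) (α : ℝ) (I : Set ℝ)
    (A : ℝ → Set (AmbientSpace n)) : Prop :=
  ∀ (a b : ℝ) (Ω : ℝ → Set (AmbientSpace n)), a < b → Icc a b ⊆ I →
    IsSmoothSupersolution f α a b Ω → A a ⊆ Ω a → ∀ t ∈ Icc a b, A t ⊆ Ω t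

/-- Barrier solutions on the time interval `I`. -/
def IsBarrierSolution {n : ℕ} (f : (Fin n → ℝ) → ℝ) (α : ℝ) (I : Set ℝ)
    (A : ℝ → Set (AmbientSpace n)) : Prop :=
  IsOuterBarrier f α I A ∧ IsInnerBarrier f α I A

/-- The open cylindrical piece `Bⁿ_r(0) × (-L, L)`, for `r ≥ 0`. -/
def openCylinder (n : ℕ) (r L : ℝ) : Set (AmbientSpace n) :=
  {x | ∑ i : Fin n, x i.castSucc ^ 2 < r ^ 2 ∧ x (Fin.last n) ∈ Ioo (-L) L}

/-- The closed infinite cylinder of radius `r ≥ 0` about the axis. -/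
def closedCylinder (n : ℕ) (r : ℝ) : Set (AmbientSpace n) :=
  {x | ∑ i : Fin n, x i.castSucc ^ 2 ≤ r ^ 2}

/-- The segment `{0} × [c, d]` on the axis. -/
def axisSegment (n : ℕ) (c d : ℝ) : Set (AmbientSpace n) :=
  {x | (∀ i : Fin n, x i.castSucc = 0) ∧ x (Fin.last n) ∈ Icc c d}

/-- The radius `r(t) = (1 - (1 + α) f̂(0)^α t)^{1/(1+α)}` of the shrinking cylinder. -/
def cylinderRadius {n : ℕ} [NeZero n] (f : (Fin n → ℝ) → ℝ) (α t : ℝ) : ℝ :=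
  (1 - (1 + α) * fHat f 0 ^ α * t) ^ (1 / (1 + α))

/-- The time `1 / ((1 + α) f̂(0)^α)` at which the radius of the shrinking cylinder reaches zero,
for `f̂(0) > 0`. -/
def collapseTime {n : ℕ} [NeZero n] (f : (Fin n → ℝ) → ℝ) (α : ℝ) : ℝ :=
  1 / ((1 + α) * fHat f 0 ^ α)

/-- The function `(∑ κᵢ²)^{1/2}`, which gives the norm `|A|` of the second fundamental form. -/
def secondFormNorm (n : ℕ) (κ : Fin n → ℝ) : ℝ := Real.sqrt (∑ i, κ i ^ 2)

end

/-! Barrier solutions are compared with explicit solids of revolution |x'|²/R² + v(y) ≤ 1, with x'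
the radial and y the axial coordinate. On their boundary all principal curvatures but one equal
1/(R√N), N = 1 - v + R²v_y²/4, and the remaining one is x times as large. By homogeneity the flow
inequality becomes a scalar comparison of N^((1-α)/2) f̂(x)^α with R^α(-R'(1-v) + R v_t/2).

From outside, take v = e(y - y₀)² with eR² ≤ 1. Then 1 - v ≤ N ≤ 1 and f̂(x) ≥ f̂(0), so this is a
supersolution whenever R shrinks no faster than the cylinder. Long ellipsoids give the cylinder
bound, static balls give boundedness, and large static balls show that axial half-spaces persist.

From inside, a compact subsolution is needed whose middle shrinks like the cylinder. Take v = V(s₁)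
+ V(s₂) with s = ±(y - y₀)/R - A(t), A decreasing linearly, and put p = V'. The motion of the caps
contributes a multiple of p(s₁) + p(s₂) on the right. Up to errors of order p, the inequality asks
for g(x) ≲ p with x of order p' + p², that is, p' ≲ g⁻¹(p). A slope obeying this rises from near 0
to order one over a length controlled by ∫ dz/g⁻¹(z), so convergence of the integral yields caps of
length comparable to R (`CylindricalDegeneracy.exists_isCapProfile`,
`IsSpeedFunction.exists_cap_inequality`). A small parameter ε keeps V strictly convex; the smaller
it is, the more of the open cylinder the solid fills.

The outcome is `IsSpeedFunction.exists_cylinder_step`: a piece of radius ρ loses at most 2ρ at each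
end during time τρ^(1+α). One step with ρ = 1 is part (1). In part (2) each step multiplies the
radius by a fixed θ < 1, so the losses form a geometric series and a definite axial segment survives
until collapse. Together with the outer cylinder this excludes convergence to a point; for convex
slices, monotonicity of the axial extent identifies the limiting segment. For |A| one has g(x) =
O(x²), so 1/g⁻¹(z) = O(z^(-1/2)) is integrable. -/

noncomputable section

/-! ### Axial coordinates and frames adapted to the axis. -/

/-- The unit vector along the axis. -/
def axisVector (n : ℕ) : AmbientSpace n := EuclideanSpace.single (Fin.last n) 1

lemma inner_axisVector {n : ℕ} (x : AmbientSpace n) :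
    inner ℝ (axisVector n) x = x (Fin.last n) := by
  simp [axisVector, EuclideanSpace.inner_single_left]

lemma norm_axisVector (n : ℕ) : ‖axisVector n‖ = 1 := by simp [axisVector]

/-- The squared distance from the axis. -/
def radialSq {n : ℕ} (x : AmbientSpace n) : ℝ := ∑ i : Fin n, x i.castSucc ^ 2

lemma radialSq_nonneg {n : ℕ} (x : AmbientSpace n) : 0 ≤ radialSq x :=
  Finset.sum_nonneg fun _ _ => sq_nonneg _

lemma norm_sq_eq_radialSq_add {n : ℕ} (x : AmbientSpace n) :
    ‖x‖ ^ 2 = radialSq x + x (Fin.last n) ^ 2 := by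
  rw [EuclideanSpace.real_norm_sq_eq, Fin.sum_univ_castSucc, radialSq]

lemma abs_last_le_norm {n : ℕ} (x : AmbientSpace n) : |x (Fin.last n)| ≤ ‖x‖ := by
  have h := norm_sq_eq_radialSq_add x
  have h0 := radialSq_nonneg x
  exact abs_le_of_sq_le_sq (by nlinarith) (norm_nonneg _)

lemma radialSq_le_norm_sq {n : ℕ} (x : AmbientSpace n) : radialSq x ≤ ‖x‖ ^ 2 := by
  rw [norm_sq_eq_radialSq_add]
  nlinarith [sq_nonneg (x (Fin.last n))]

/-- An orthonormal frame of `ν^⊥` all of whose members but one are orthogonal to `b`. -/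
lemma exists_adapted_frame {n : ℕ} [NeZero n] (ν b : AmbientSpace n) (hν : ‖ν‖ = 1) :
    ∃ e : Fin n → AmbientSpace n, Orthonormal ℝ e ∧ (∀ i, inner ℝ ν (e i) = 0) ∧
      (∀ i, i ≠ 0 → inner ℝ b (e i) = 0) ∧
      inner ℝ b (e 0) ^ 2 = ‖b‖ ^ 2 - inner ℝ ν b ^ 2 := by
  have hνν : inner ℝ ν ν = (1 : ℝ) := by rw [real_inner_self_eq_norm_sq, hν]; norm_num
  set w : AmbientSpace n := b - (inner ℝ ν b : ℝ) • ν with hw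
  have hνw : inner ℝ ν w = (0 : ℝ) := by
    rw [hw, inner_sub_right, inner_smul_right, hνν]; ring
  have hcard : Module.finrank ℝ (AmbientSpace n) = Fintype.card (Fin (n + 1)) := by simp
  have h0l : (0 : Fin n).castSucc ≠ Fin.last n := (Fin.castSucc_lt_last _).ne
  have key : ∀ k : Fin (n + 1), k ≠ Fin.last n →
      ∃ B : OrthonormalBasis (Fin (n + 1)) ℝ (AmbientSpace n),
        B (Fin.last n) = ν ∧ ∃ c : ℝ, w = c • B k := by
    intro k hk
    -- When b is parallel to ν, as at the poles, no tangent direction is distinguished and any frame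
    -- of ν^⊥ serves.
    by_cases hw0 : w = 0
    · have ho : Orthonormal ℝ (({Fin.last n} : Set (Fin (n + 1))).domRestrict fun _ => ν) :=
        ⟨fun _ => hν, fun i j hij => absurd (Subsingleton.elim i j) hij⟩
      obtain ⟨B, hB⟩ := ho.exists_orthonormalBasis_extension_of_card_eq hcard
      exact ⟨B, hB _ rfl, 0, by simp [hw0]⟩
    · have hwn : ‖w‖ ≠ 0 := by simpa using hw0
      have hvk : Function.update (fun _ => ν) k (‖w‖⁻¹ • w) k = ‖w‖⁻¹ • w :=
        Function.update_self ..
      have hvl : Function.update (fun _ => ν) k (‖w‖⁻¹ • w) (Fin.last n) = ν :=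
        Function.update_of_ne hk.symm ..
      have ho : Orthonormal ℝ (({k, Fin.last n} : Set (Fin (n + 1))).domRestrict
          (Function.update (fun _ => ν) k (‖w‖⁻¹ • w))) := by
        refine ⟨?_, ?_⟩
        · rintro ⟨i, rfl | rfl⟩
          · rw [domRestrict_apply, hvk]
            simp [norm_smul, hwn]
          · rw [domRestrict_apply, hvl, hν]
        · rintro ⟨i, rfl | rfl⟩ ⟨j, rfl | rfl⟩ hij
          · exact absurd rfl hij
          · simp only [domRestrict_apply]
            rw [hvk, hvl, inner_smul_left, real_inner_comm, hνw, mul_zero]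
          · simp only [domRestrict_apply]
            rw [hvk, hvl, inner_smul_right, hνw, mul_zero]
          · exact absurd rfl hij
      obtain ⟨B, hB⟩ := ho.exists_orthonormalBasis_extension_of_card_eq hcard
      refine ⟨B, ?_, ‖w‖, ?_⟩
      · rw [hB _ (by simp), hvl]
      · rw [hB _ (by simp), hvk, smul_smul, mul_inv_cancel₀ hwn, one_smul]
  obtain ⟨B, hBl, c, hBc⟩ := key _ h0l
  have hb : b = c • B (0 : Fin n).castSucc + (inner ℝ ν b : ℝ) • B (Fin.last n) := by
    rw [← hBc, hBl, hw]; abel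
  have hin : ∀ i j, inner ℝ (B i) (B j) = if i = j then (1 : ℝ) else 0 :=
    orthonormal_iff_ite.mp B.orthonormal
  have hbi : ∀ i : Fin n, inner ℝ b (B i.castSucc) = if (0 : Fin n) = i then c else 0 := by
    intro i
    have hil : Fin.last n ≠ i.castSucc := (Fin.castSucc_lt_last _).ne'
    conv_lhs => rw [hb]
    rw [inner_add_left, inner_smul_left, inner_smul_left, hin, hin, if_neg hil]
    simp [eq_comm]
  refine ⟨fun i => B i.castSucc, B.orthonormal.comp _ (Fin.castSucc_injective n), fun i => ?_,
    fun i hi => ?_, ?_⟩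
  · rw [← hBl, hin, if_neg (Fin.castSucc_lt_last _).ne']
  · rw [hbi, if_neg (Ne.symm hi)]
  · rw [hbi, if_pos rfl]
    have h1 : ‖b‖ ^ 2 = inner ℝ b b := (real_inner_self_eq_norm_sq b).symm
    have h2 : inner ℝ b (B (Fin.last n)) = (inner ℝ ν b : ℝ) := by rw [hBl, real_inner_comm]
    have h3 : inner ℝ b b = c * c + (inner ℝ ν b : ℝ) * inner ℝ ν b := by
      have h4 : inner ℝ b (c • B (0 : Fin n).castSucc + (inner ℝ ν b : ℝ) • B (Fin.last n)) =
          c * c + (inner ℝ ν b : ℝ) * inner ℝ ν b := by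
        rw [inner_add_right, inner_smul_right, inner_smul_right, hbi, if_pos rfl, h2]
      rwa [← hb] at h4
    rw [h1, h3]; ring

/-! ### Principal curvatures of level sets of rotationally symmetric functions. -/

section AxialFunctions

variable {n : ℕ}

lemma hasFDerivAt_axial (A : ℝ) {ψ ψ₁ : ℝ → ℝ} (h₁ : ∀ y, HasDerivAt ψ (ψ₁ y) y)
    (x : AmbientSpace n) :
    HasFDerivAt (fun x : AmbientSpace n => A * ‖x‖ ^ 2 + ψ (x (Fin.last n)))
      ((2 * A) • innerSL ℝ x + ψ₁ (x (Fin.last n)) • innerSL ℝ (axisVector n)) x := by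
  have h := ((hasStrictFDerivAt_norm_sq x).hasFDerivAt.const_mul A)
  have hl : HasFDerivAt (fun x : AmbientSpace n => x (Fin.last n)) (innerSL ℝ (axisVector n)) x := by
    have := (innerSL ℝ (axisVector n)).hasFDerivAt (x := x)
    refine this.congr_of_eventuallyEq (Eventually.of_forall fun z => ?_)
    simp [inner_axisVector]
  have h' := (h₁ (x (Fin.last n))).comp_hasFDerivAt x hl
  refine (h.add h').congr_fderiv ?_
  ext z
  simp
  ring

lemma gradient_axial (A : ℝ) {ψ ψ₁ : ℝ → ℝ} (h₁ : ∀ y, HasDerivAt ψ (ψ₁ y) y)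
    (x : AmbientSpace n) :
    gradient (fun x : AmbientSpace n => A * ‖x‖ ^ 2 + ψ (x (Fin.last n))) x =
      (2 * A) • x + ψ₁ (x (Fin.last n)) • axisVector n := by
  apply HasGradientAt.gradient
  rw [hasGradientAt_iff_hasFDerivAt]
  refine (hasFDerivAt_axial A h₁ x).congr_fderiv ?_
  ext z
  simp

lemma fderiv_fderiv_axial (A : ℝ) {ψ ψ₁ ψ₂ : ℝ → ℝ} (h₁ : ∀ y, HasDerivAt ψ (ψ₁ y) y)
    (h₂ : ∀ y, HasDerivAt ψ₁ (ψ₂ y) y) (x u w : AmbientSpace n) :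
    fderiv ℝ (fderiv ℝ (fun x : AmbientSpace n => A * ‖x‖ ^ 2 + ψ (x (Fin.last n)))) x u w =
      2 * A * inner ℝ u w + ψ₂ (x (Fin.last n)) * inner ℝ (axisVector n) u *
        inner ℝ (axisVector n) w := by
  have hf : fderiv ℝ (fun x : AmbientSpace n => A * ‖x‖ ^ 2 + ψ (x (Fin.last n))) =
      fun x => (2 * A) • innerSL ℝ x + ψ₁ (x (Fin.last n)) • innerSL ℝ (axisVector n) :=
    funext fun x => (hasFDerivAt_axial A h₁ x).fderiv
  have hl : HasFDerivAt (fun x : AmbientSpace n => x (Fin.last n)) (innerSL ℝ (axisVector n)) x := by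
    have := (innerSL ℝ (axisVector n)).hasFDerivAt (x := x)
    refine this.congr_of_eventuallyEq (Eventually.of_forall fun z => ?_)
    simp [inner_axisVector]
  have h' := (h₂ (x (Fin.last n))).comp_hasFDerivAt x hl
  have h3 : HasFDerivAt (fun x : AmbientSpace n => innerSL ℝ x) (innerSL ℝ) x :=
    (innerSL ℝ (E := AmbientSpace n)).hasFDerivAt
  have h4 : HasFDerivAt (fun x : AmbientSpace n => (2 * A) • innerSL ℝ x +
      ψ₁ (x (Fin.last n)) • innerSL ℝ (axisVector n)) _ x :=
    (h3.const_smul (2 * A)).add (h'.smul_const (innerSL ℝ (axisVector n)))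
  rw [hf, h4.fderiv]
  simp
  exact Or.inl rfl

lemma norm_sq_gradient_axial (A : ℝ) {ψ ψ₁ : ℝ → ℝ} (h₁ : ∀ y, HasDerivAt ψ (ψ₁ y) y)
    (x : AmbientSpace n) :
    ‖gradient (fun x : AmbientSpace n => A * ‖x‖ ^ 2 + ψ (x (Fin.last n))) x‖ ^ 2 =
      4 * A ^ 2 * radialSq x + (ψ₁ (x (Fin.last n)) + 2 * A * x (Fin.last n)) ^ 2 := by
  rw [gradient_axial A h₁, norm_add_sq_real, norm_smul, norm_smul, mul_pow, mul_pow,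
    norm_axisVector, norm_sq_eq_radialSq_add, inner_smul_left, inner_smul_right, real_inner_comm,
    inner_axisVector]
  simp only [Real.norm_eq_abs, sq_abs, conj_trivial]
  ring

/-- The Hessian is 2A·id + ψ₂ b⊗b with b the axis vector, so a tangent frame in which only `e 0`
fails to be orthogonal to b diagonalises it. The exceptional entry comes from ⟨b, e 0⟩² = 1 - ⟨ν,
b⟩² = 4A² `radialSq x` / N². -/
lemma isPrincipalCurvatures_axial [NeZero n] (A : ℝ) {ψ ψ₁ ψ₂ : ℝ → ℝ}
    (h₁ : ∀ y, HasDerivAt ψ (ψ₁ y) y) (h₂ : ∀ y, HasDerivAt ψ₁ (ψ₂ y) y) (x : AmbientSpace n)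
    {N : ℝ} (hN : 0 < N)
    (hNx : N ^ 2 = 4 * A ^ 2 * radialSq x + (ψ₁ (x (Fin.last n)) + 2 * A * x (Fin.last n)) ^ 2) :
    IsPrincipalCurvatures (fun x : AmbientSpace n => A * ‖x‖ ^ 2 + ψ (x (Fin.last n))) x
      (Function.update (fun _ => 2 * A / N) 0
        ((2 * A * (ψ₁ (x (Fin.last n)) + 2 * A * x (Fin.last n)) ^ 2 +
          4 * A ^ 2 * radialSq x * (ψ₂ (x (Fin.last n)) + 2 * A)) / N ^ 3)) := by
  set G := gradient (fun x : AmbientSpace n => A * ‖x‖ ^ 2 + ψ (x (Fin.last n))) x with hG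
  have hGN : ‖G‖ = N := by
    have h := norm_sq_gradient_axial A h₁ x
    rw [← hNx] at h
    exact (pow_left_inj₀ (norm_nonneg _) hN.le two_ne_zero).mp h
  have hν : ‖N⁻¹ • G‖ = 1 := by
    rw [norm_smul, hGN, norm_inv, Real.norm_of_nonneg hN.le, inv_mul_cancel₀ hN.ne']
  obtain ⟨e, he, heν, heb, heb0⟩ := exists_adapted_frame (N⁻¹ • G) (axisVector n) hν
  have hperp : ∀ i, inner ℝ G (e i) = (0 : ℝ) := by
    intro i
    have := heν i
    rw [inner_smul_left] at this
    simpa [hN.ne'] using this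
  refine ⟨e, he, hperp, fun i j => ?_⟩
  rw [fderiv_fderiv_axial A h₁ h₂, orthonormal_iff_ite.mp he i j, hGN]
  by_cases hij : i = j
  · subst hij
    by_cases hi : i = 0
    · subst hi
      have hGb : inner ℝ G (axisVector n) =
          ψ₁ (x (Fin.last n)) + 2 * A * x (Fin.last n) := by
        rw [hG, gradient_axial A h₁, inner_add_left, inner_smul_left, inner_smul_left,
          real_inner_comm, inner_axisVector, real_inner_self_eq_norm_sq, norm_axisVector]
        simp; ring
      have hsq : inner ℝ (axisVector n) (e 0) * inner ℝ (axisVector n) (e 0) =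
          4 * A ^ 2 * radialSq x / N ^ 2 := by
        rw [← sq, heb0, norm_axisVector, inner_smul_left, hGb]
        have hN2 : N ^ 2 ≠ 0 := by positivity
        rw [eq_div_iff hN2]
        simp only [conj_trivial]
        field_simp
        linarith
      rw [mul_assoc (ψ₂ _), hsq]
      simp only [if_true, Function.update_self]
      have hN2 : N ^ 2 ≠ 0 := by positivity
      field_simp
      linear_combination (2 * A) * hNx
    · simp [hi]
      field_simp
      simp [heb i hi]
  · simp only [if_neg hij, mul_zero, zero_add]
    by_cases hi : i = 0
    · rw [heb j (by rintro rfl; exact hij hi)]; simp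
    · rw [heb i hi]; simp

end AxialFunctions

/-! ### Monotonicity of the speed and its boundary value f̂(0). -/

section SpeedFunction

variable {n : ℕ} {f : (Fin n → ℝ) → ℝ}

lemma isOpen_positiveCone (n : ℕ) : IsOpen (positiveCone n) := by
  have : positiveCone n = ⋂ i, (fun κ : Fin n → ℝ => κ i) ⁻¹' Ioi 0 := by
    ext; simp [positiveCone]
  rw [this]
  exact isOpen_iInter_of_finite fun i => isOpen_Ioi.preimage (continuous_apply i)

lemma IsSpeedFunction.mono (hf : IsSpeedFunction f) {κ κ' : Fin n → ℝ} (hκ : κ ∈ positiveCone n)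
    (h : ∀ i, κ i ≤ κ' i) : f κ ≤ f κ' := by
  have hmem : ∀ t ∈ Icc (0 : ℝ) 1, κ + t • (κ' - κ) ∈ positiveCone n := by
    intro t ht i
    have h1 := hκ i
    have h2 := mul_nonneg ht.1 (sub_nonneg.mpr (h i))
    simp only [Pi.add_apply, Pi.smul_apply, Pi.sub_apply, smul_eq_mul]
    linarith
  have hd : ∀ t ∈ Icc (0 : ℝ) 1, HasDerivAt (fun t : ℝ => f (κ + t • (κ' - κ)))
      (fderiv ℝ f (κ + t • (κ' - κ)) (κ' - κ)) t := by
    intro t ht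
    have h1 : HasFDerivAt f _ (κ + t • (κ' - κ)) :=
      ((hf.smooth.contDiffAt ((isOpen_positiveCone n).mem_nhds (hmem t ht))).differentiableAt
        (by simp)).hasFDerivAt
    have h2 : HasDerivAt (fun t : ℝ => κ + t • (κ' - κ)) (κ' - κ) t := by
      simpa using! ((hasDerivAt_id t).smul_const (κ' - κ)).const_add κ
    exact h1.comp_hasDerivAt t h2
  have hm : MonotoneOn (fun t : ℝ => f (κ + t • (κ' - κ))) (Icc 0 1) := by
    refine monotoneOn_of_deriv_nonneg (convex_Icc 0 1)
      (fun t ht => (hd t ht).continuousAt.continuousWithinAt)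
      (fun t ht => (hd t (interior_subset ht)).differentiableAt.differentiableWithinAt)
      fun t ht => ?_
    have ht' := interior_subset ht
    rw [(hd t ht').deriv]
    have : κ' - κ = ∑ i, (κ' i - κ i) • (Pi.single i (1 : ℝ) : Fin n → ℝ) := by
      ext j
      simp [Finset.sum_apply, Pi.single_apply]
    rw [this, map_sum]
    refine Finset.sum_nonneg fun i _ => ?_
    rw [map_smul, smul_eq_mul]
    rw [← this]
    exact mul_nonneg (sub_nonneg.mpr (h i)) (hf.increasing _ (hmem t ht') i).le
  have := hm (left_mem_Icc.mpr zero_le_one) (right_mem_Icc.mpr zero_le_one) zero_le_one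
  simpa using this

variable [NeZero n]

lemma update_mem_positiveCone {x r : ℝ} (hx : 0 < x) (hr : 0 < r) :
    Function.update (fun _ => r) (0 : Fin n) x ∈ positiveCone n := by
  intro i
  by_cases hi : i = 0
  · subst hi; simpa using hx
  · simpa [hi] using hr

/-- The limit is the infimum of f(x, 1, …, 1) over x > 0. Near (0, 1, …, 1), monotonicity and
homogeneity squeeze f between (1 - δ)ℓ and (1 + δ)f(x, 1, …, 1) for any fixed x > 0 and small δ.
Hence `fHat f 0` is a genuine limit and not a junk value of `extendFrom`. -/
lemma IsSpeedFunction.tendsto_boundary (hf : IsSpeedFunction f) :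
    ∃ ℓ : ℝ, 0 ≤ ℓ ∧ (∀ x, 0 < x → ℓ ≤ f (Function.update (fun _ => 1) 0 x)) ∧
      Tendsto f (𝓝[positiveCone n] (Function.update (fun _ => 1) 0 0)) (𝓝 ℓ) := by
  set φ : ℝ → ℝ := fun x => f (Function.update (fun _ => 1) 0 x) with hφ
  have hφpos : ∀ x, 0 < x → 0 < φ x := fun x hx =>
    hf.pos _ (update_mem_positiveCone hx one_pos)
  have hbdd : BddBelow (φ '' Ioi 0) := ⟨0, by rintro _ ⟨x, hx, rfl⟩; exact (hφpos x hx).le⟩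
  have hne : (φ '' Ioi 0).Nonempty := ⟨_, 1, mem_Ioi.mpr one_pos, rfl⟩
  set ℓ := sInf (φ '' Ioi 0) with hℓ
  have hℓ0 : 0 ≤ ℓ := le_csInf hne (by rintro _ ⟨x, hx, rfl⟩; exact (hφpos x hx).le)
  have hℓle : ∀ x, 0 < x → ℓ ≤ φ x := fun x hx => csInf_le hbdd ⟨x, hx, rfl⟩
  have hlow : ∀ (c : ℝ) (κ : Fin n → ℝ), 0 < c → κ ∈ positiveCone n →
      (∀ i, i ≠ 0 → c ≤ κ i) → c * ℓ ≤ f κ := by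
    intro c κ hc hκ h
    have h0 : 0 < κ 0 / c := div_pos (hκ 0) hc
    calc c * ℓ ≤ c * φ (κ 0 / c) := by gcongr; exact hℓle _ h0
      _ = f (c • Function.update (fun _ => 1) 0 (κ 0 / c)) :=
        (hf.homogeneous c hc _ (update_mem_positiveCone h0 one_pos)).symm
      _ ≤ f κ := by
        refine hf.mono (fun i => ?_) fun i => ?_
        · exact mul_pos hc (update_mem_positiveCone h0 one_pos i)
        · by_cases hi : i = 0
          · subst hi; simp [mul_div_cancel₀ _ hc.ne']
          · simpa [hi] using h i hi
  have hupp : ∀ (c δ : ℝ) (κ : Fin n → ℝ), 1 ≤ c → κ ∈ positiveCone n → κ 0 ≤ δ →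
      (∀ i, i ≠ 0 → κ i ≤ c) → f κ ≤ c * φ δ := by
    intro c δ κ hc hκ hδ h
    have hc0 : 0 < c := by linarith
    have hδ0 : 0 < δ := (hκ 0).trans_le hδ
    rw [hφ]
    dsimp only
    rw [← hf.homogeneous c hc0 _ (update_mem_positiveCone hδ0 one_pos)]
    refine hf.mono hκ fun i => ?_
    by_cases hi : i = 0
    · subst hi; simp; nlinarith
    · simpa [hi] using h i hi
  have hev : ∀ δ : ℝ, 0 < δ → ∀ᶠ κ in 𝓝[positiveCone n] (Function.update (fun _ => 1) 0 0),
      κ ∈ positiveCone n ∧ κ 0 ≤ δ ∧ ∀ i, i ≠ 0 → 1 - δ ≤ κ i ∧ κ i ≤ 1 + δ := by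
    intro δ hδ
    refine eventually_mem_nhdsWithin.and (eventually_nhdsWithin_of_eventually_nhds ?_)
    have h1 : ∀ i : Fin n, ∀ᶠ κ : Fin n → ℝ in 𝓝 (Function.update (fun _ => 1) 0 0),
        |κ i - Function.update (fun _ => (1 : ℝ)) (0 : Fin n) 0 i| < δ := fun i =>
      (continuous_apply i).continuousAt.eventually (eventually_abs_sub_lt _ hδ)
    filter_upwards [eventually_all.mpr h1] with κ hκ
    refine ⟨?_, fun i hi => ?_⟩
    · have := hκ 0
      simp at this
      exact (abs_lt.mp this).2.le
    · have := hκ i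
      simp [hi] at this
      have := abs_lt.mp this
      constructor <;> linarith
  refine ⟨ℓ, hℓ0, hℓle, tendsto_order.mpr ⟨fun a ha => ?_, fun a ha => ?_⟩⟩
  · obtain ⟨δ, hδ, hδ1, hδa⟩ : ∃ δ : ℝ, 0 < δ ∧ δ < 1 ∧ a < (1 - δ) * ℓ := by
      have : Tendsto (fun δ : ℝ => (1 - δ) * ℓ) (𝓝[>] 0) (𝓝 ((1 - 0) * ℓ)) :=
        ((continuous_const.sub continuous_id).mul continuous_const).continuousAt.tendsto.mono_left
          nhdsWithin_le_nhds
      have h1 := this.eventually (lt_mem_nhds (by simpa using ha))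
      obtain ⟨δ, h, hδ⟩ := (h1.and (Ioo_mem_nhdsGT one_pos)).exists
      exact ⟨δ, hδ.1, hδ.2, h⟩
    filter_upwards [hev δ hδ] with κ hκ
    exact hδa.trans_le (hlow _ κ (by linarith) hκ.1 fun i hi => (hκ.2.2 i hi).1)
  · obtain ⟨_, ⟨x, hx, rfl⟩, hxa⟩ := exists_lt_of_csInf_lt hne ha
    obtain ⟨δ, hδ, hδ1, hδa⟩ : ∃ δ : ℝ, 0 < δ ∧ δ < x ∧ (1 + δ) * φ x < a := by
      have : Tendsto (fun δ : ℝ => (1 + δ) * φ x) (𝓝[>] 0) (𝓝 ((1 + 0) * φ x)) :=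
        ((continuous_const.add continuous_id).mul continuous_const).continuousAt.tendsto.mono_left
          nhdsWithin_le_nhds
      have h1 := this.eventually (gt_mem_nhds (by simpa using hxa))
      obtain ⟨δ, h, hδ⟩ := (h1.and (Ioo_mem_nhdsGT hx)).exists
      exact ⟨δ, hδ.1, hδ.2, h⟩
    filter_upwards [hev δ hδ] with κ hκ
    exact (hupp _ x κ (by linarith) hκ.1 (hκ.2.1.trans hδ1.le)
      fun i hi => (hκ.2.2 i hi).2).trans_lt hδa

lemma mem_closure_positiveCone {x : ℝ} (hx : 0 ≤ x) :
    Function.update (fun _ => 1) (0 : Fin n) x ∈ closure (positiveCone n) := by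
  have h : Tendsto (fun s : ℝ => Function.update (fun _ => (1 : ℝ)) (0 : Fin n) (x + s)) (𝓝[>] 0)
      (𝓝 (Function.update (fun _ => 1) 0 (x + 0))) := by
    refine Tendsto.mono_left ?_ nhdsWithin_le_nhds
    exact (continuous_const.update 0 (continuous_const.add continuous_id)).tendsto 0
  rw [add_zero] at h
  refine mem_closure_of_tendsto h ?_
  filter_upwards [self_mem_nhdsWithin] with s hs
  exact update_mem_positiveCone (add_pos_of_nonneg_of_pos hx hs) one_pos

lemma fHat_eq_of_continuousAt {x : ℝ} (hx : 0 ≤ x)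
    (h : ContinuousAt f (Function.update (fun _ => 1) 0 x)) :
    fHat f x = f (Function.update (fun _ => 1) 0 x) :=
  extendFrom_eq (mem_closure_positiveCone hx) (h.tendsto.mono_left nhdsWithin_le_nhds)

lemma IsSpeedFunction.fHat_of_pos (hf : IsSpeedFunction f) {x : ℝ} (hx : 0 < x) :
    fHat f x = f (Function.update (fun _ => 1) 0 x) :=
  fHat_eq_of_continuousAt hx.le (hf.smooth.continuousOn.continuousAt
    ((isOpen_positiveCone n).mem_nhds (update_mem_positiveCone hx one_pos)))

lemma IsSpeedFunction.fHat_zero_nonneg (hf : IsSpeedFunction f) : 0 ≤ fHat f 0 := by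
  obtain ⟨ℓ, h0, -, h⟩ := hf.tendsto_boundary
  rwa [fHat, extendFrom_eq (mem_closure_positiveCone le_rfl) h]

lemma IsSpeedFunction.fHat_mono (hf : IsSpeedFunction f) {x y : ℝ} (hx : 0 ≤ x) (hxy : x ≤ y) :
    fHat f x ≤ fHat f y := by
  rcases hx.eq_or_lt with rfl | hx
  · rcases hxy.eq_or_lt with rfl | hy
    · rfl
    · obtain ⟨ℓ, -, h1, h⟩ := hf.tendsto_boundary
      rw [fHat, extendFrom_eq (mem_closure_positiveCone le_rfl) h, hf.fHat_of_pos hy]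
      exact h1 y hy
  · rw [hf.fHat_of_pos hx, hf.fHat_of_pos (hx.trans_le hxy)]
    refine hf.mono (update_mem_positiveCone hx one_pos) fun i => ?_
    by_cases hi : i = 0
    · subst hi; simpa using hxy
    · simp [hi]

lemma IsSpeedFunction.fHat_nonneg (hf : IsSpeedFunction f) {x : ℝ} (hx : 0 ≤ x) : 0 ≤ fHat f x :=
  hf.fHat_zero_nonneg.trans (hf.fHat_mono le_rfl hx)

/-- The speed at a point with one principal curvature `c * x` and the others equal to `c`. -/
lemma IsSpeedFunction.apply_update (hf : IsSpeedFunction f) {c x : ℝ} (hc : 0 < c) (hx : 0 < x) :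
    f (Function.update (fun _ => c) 0 (c * x)) = c * fHat f x := by
  rw [hf.fHat_of_pos hx, ← hf.homogeneous c hc _ (update_mem_positiveCone hx one_pos)]
  congr 1
  ext i
  by_cases hi : i = 0
  · subst hi; simp
  · simp [hi]

end SpeedFunction

/-! ### Solids of revolution and the scalar form of the flow inequality. -/

/-- The solid of revolution whose squared radius at height `y` is `r² (1 - v y)`. -/
def solidOfRevolution (n : ℕ) (r : ℝ) (v : ℝ → ℝ) : Set (AmbientSpace n) :=
  {x | radialSq x / r ^ 2 + v (x (Fin.last n)) ≤ 1}

/-- A smooth one-parameter family of profiles `(R, v)`, with derivatives, such that the solids of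
revolution `solidOfRevolution n (R t) (v t)` are strictly convex with smooth boundary. -/
structure IsProfileFamily (a b : ℝ) (R R' : ℝ → ℝ) (v v₁ v₂ vt : ℝ → ℝ → ℝ) : Prop where
  lt : a < b
  pos : ∀ t ∈ Icc a b, 0 < R t
  smooth_radius : ContDiffOn ℝ ∞ R (Icc a b)
  deriv_radius : ∀ t ∈ Icc a b, HasDerivWithinAt R (R' t) (Icc a b) t
  smooth : ContDiffOn ℝ ∞ (fun p : ℝ × ℝ => v p.1 p.2) (Icc a b ×ˢ univ)
  deriv_one : ∀ t ∈ Icc a b, ∀ y, HasDerivAt (v t) (v₁ t y) y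
  deriv_two : ∀ t ∈ Icc a b, ∀ y, HasDerivAt (v₁ t) (v₂ t y) y
  deriv_time : ∀ t ∈ Icc a b, ∀ y, HasDerivWithinAt (fun s => v s y) (vt t y) (Icc a b) t
  convex : ∀ t ∈ Icc a b, ∀ y, 0 < v₂ t y
  regular : ∀ t ∈ Icc a b, ∀ y, v t y = 1 → v₁ t y ≠ 0

/-- The squared length `1 - v + R² v_y² / 4` of the rescaled normal. -/
def normalSq (R v v₁ : ℝ) : ℝ := 1 - v + R ^ 2 * v₁ ^ 2 / 4

/-- The ratio of the axial to the rotational principal curvature. -/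
def curvatureRatio (R v v₁ v₂ : ℝ) : ℝ :=
  (R ^ 2 * v₁ ^ 2 / 4 + R ^ 2 * v₂ * (1 - v) / 2) / normalSq R v v₁

namespace IsProfileFamily

variable {a b : ℝ} {R R' : ℝ → ℝ} {v v₁ v₂ vt : ℝ → ℝ → ℝ} {n : ℕ}

/-- The defining function of a family of solids of revolution. -/
def definingFun (n : ℕ) (R : ℝ → ℝ) (v : ℝ → ℝ → ℝ) (t : ℝ) (x : AmbientSpace n) : ℝ :=
  (R t ^ 2)⁻¹ * ‖x‖ ^ 2 + (v t (x (Fin.last n)) - 1 - (R t ^ 2)⁻¹ * x (Fin.last n) ^ 2)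

lemma definingFun_eq (t : ℝ) (x : AmbientSpace n) :
    definingFun n R v t x = radialSq x / R t ^ 2 + v t (x (Fin.last n)) - 1 := by
  rw [definingFun, norm_sq_eq_radialSq_add]; ring

lemma speed_rpow_eq {α R N F : ℝ} (hR : 0 < R) (hN : 0 < N) (hF : 0 ≤ F) :
    ((R * √N)⁻¹ * F) ^ α = N ^ ((1 - α) / 2) * F ^ α / (R ^ α * √N) := by
  have hs : 0 < √N := Real.sqrt_pos.mpr hN
  rw [Real.mul_rpow (by positivity) hF, Real.inv_rpow (by positivity), Real.mul_rpow hR.le hs.le,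
    Real.sqrt_eq_rpow, ← Real.rpow_mul hN.le, sub_div, Real.rpow_sub hN, one_div_mul_eq_div]
  field_simp

lemma normalSq_pos (H : IsProfileFamily a b R R' v v₁ v₂ vt) {t : ℝ} (ht : t ∈ Icc a b) {y : ℝ} (hy : v t y ≤ 1) :
    0 < normalSq (R t) (v t y) (v₁ t y) := by
  have hR := H.pos t ht
  rw [normalSq]
  rcases hy.lt_or_eq with h | h
  · have : 0 ≤ R t ^ 2 * v₁ t y ^ 2 / 4 := by positivity
    linarith
  · have := H.regular t ht y h
    have : 0 < R t ^ 2 * v₁ t y ^ 2 / 4 := by positivity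
    linarith

lemma curvatureRatio_pos (H : IsProfileFamily a b R R' v v₁ v₂ vt) {t : ℝ} (ht : t ∈ Icc a b) {y : ℝ} (hy : v t y ≤ 1) :
    0 < curvatureRatio (R t) (v t y) (v₁ t y) (v₂ t y) := by
  have hR := H.pos t ht
  have h2 := H.convex t ht y
  refine div_pos ?_ (H.normalSq_pos ht hy)
  rcases hy.lt_or_eq with h | h
  · have h3 : 0 < 1 - v t y := by linarith
    positivity
  · have := H.regular t ht y h
    rw [h]
    have : 0 < R t ^ 2 * v₁ t y ^ 2 / 4 := by positivity
    linarith

lemma deriv_axial_one (H : IsProfileFamily a b R R' v v₁ v₂ vt) {t : ℝ} (ht : t ∈ Icc a b) (y : ℝ) :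
    HasDerivAt (fun y => v t y - 1 - (R t ^ 2)⁻¹ * y ^ 2) (v₁ t y - (R t ^ 2)⁻¹ * (2 * y)) y := by
  have := ((H.deriv_one t ht y).sub_const 1).sub ((hasDerivAt_pow 2 y).const_mul (R t ^ 2)⁻¹)
  simpa using! this

lemma deriv_axial_two (H : IsProfileFamily a b R R' v v₁ v₂ vt) {t : ℝ} (ht : t ∈ Icc a b) (y : ℝ) :
    HasDerivAt (fun y => v₁ t y - (R t ^ 2)⁻¹ * (2 * y)) (v₂ t y - (R t ^ 2)⁻¹ * 2) y := by
  have := (H.deriv_two t ht y).sub (((hasDerivAt_id y).const_mul 2).const_mul (R t ^ 2)⁻¹)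
  simpa using! this

lemma norm_gradient (H : IsProfileFamily a b R R' v v₁ v₂ vt) {t : ℝ} (ht : t ∈ Icc a b) {x : AmbientSpace n}
    (hx : definingFun n R v t x = 0) :
    ‖gradient (definingFun n R v t) x‖ =
      2 / R t * √(normalSq (R t) (v t (x (Fin.last n))) (v₁ t (x (Fin.last n)))) := by
  have hR := H.pos t ht
  have hρ : radialSq x = R t ^ 2 * (1 - v t (x (Fin.last n))) := by
    rw [definingFun_eq] at hx
    field_simp at hx
    linarith
  have hv : v t (x (Fin.last n)) ≤ 1 := by
    have := radialSq_nonneg x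
    rw [hρ] at this
    have := nonneg_of_mul_nonneg_right this (by positivity)
    linarith
  have h := norm_sq_gradient_axial (R t ^ 2)⁻¹ (H.deriv_axial_one ht) x
  refine (pow_left_inj₀ (norm_nonneg _) (by positivity) two_ne_zero).mp (h.trans ?_)
  rw [mul_pow, Real.sq_sqrt (H.normalSq_pos ht hv).le, hρ, normalSq]
  field_simp
  ring

lemma isSmoothFamily (H : IsProfileFamily a b R R' v v₁ v₂ vt) (n : ℕ) : IsSmoothFamily a b (definingFun n R v)
    (fun t => solidOfRevolution n (R t) (v t)) where
  smooth := by
    have hf : ContDiffOn ℝ ∞ (fun p : ℝ × AmbientSpace n => (R p.1 ^ 2)⁻¹) (Icc a b ×ˢ univ) :=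
      ((H.smooth_radius.comp contDiffOn_fst fun p hp => hp.1).pow 2).inv
        fun p hp => (pow_pos (H.pos _ hp.1) 2).ne'
    have hl : ContDiff ℝ ∞ (fun p : ℝ × AmbientSpace n => p.2 (Fin.last n)) := by
      have : (fun p : ℝ × AmbientSpace n => p.2 (Fin.last n)) =
          fun p => innerSL ℝ (axisVector n) p.2 := by
        ext p; simp [inner_axisVector]
      rw [this]
      exact (innerSL ℝ (axisVector n)).contDiff.comp contDiff_snd
    have hv : ContDiffOn ℝ ∞ (fun p : ℝ × AmbientSpace n => v p.1 (p.2 (Fin.last n)))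
        (Icc a b ×ˢ univ) :=
      H.smooth.comp (contDiffOn_fst.prodMk hl.contDiffOn) fun p hp => ⟨hp.1, mem_univ _⟩
    exact (hf.mul (contDiff_snd.norm_sq ℝ).contDiffOn).add
      ((hv.sub contDiffOn_const).sub (hf.mul (hl.pow 2).contDiffOn))
  regular := by
    intro t ht x hx h0
    have hR := H.pos t ht
    have h := H.norm_gradient ht hx
    have hv : v t (x (Fin.last n)) ≤ 1 := by
      rw [definingFun_eq] at hx
      have : 0 ≤ radialSq x / R t ^ 2 := div_nonneg (radialSq_nonneg x) (sq_nonneg _)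
      linarith
    have hN := H.normalSq_pos ht hv
    rw [h0, norm_zero] at h
    have : 0 < 2 / R t * √(normalSq (R t) (v t (x (Fin.last n))) (v₁ t (x (Fin.last n)))) := by
      positivity
    linarith
  eq_sublevel := by
    intro t _
    ext x
    simp only [solidOfRevolution, mem_ofPred_eq, definingFun_eq, sub_nonpos]

lemma exists_isPrincipalCurvatures [NeZero n] (H : IsProfileFamily a b R R' v v₁ v₂ vt) {f : (Fin n → ℝ) → ℝ} (hf : IsSpeedFunction f)
    {t : ℝ} (ht : t ∈ Icc a b) {x : AmbientSpace n} (hx : definingFun n R v t x = 0) :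
    ∃ κ ∈ positiveCone n, IsPrincipalCurvatures (definingFun n R v t) x κ ∧
      f κ = (R t * √(normalSq (R t) (v t (x (Fin.last n))) (v₁ t (x (Fin.last n)))))⁻¹ *
        fHat f (curvatureRatio (R t) (v t (x (Fin.last n))) (v₁ t (x (Fin.last n)))
          (v₂ t (x (Fin.last n)))) := by
  have hR := H.pos t ht
  have hρ : radialSq x = R t ^ 2 * (1 - v t (x (Fin.last n))) := by
    rw [definingFun_eq] at hx
    field_simp at hx
    linarith
  have hv : v t (x (Fin.last n)) ≤ 1 := by
    have := radialSq_nonneg x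
    rw [hρ] at this
    have := nonneg_of_mul_nonneg_right this (by positivity)
    linarith
  have hNpos := H.normalSq_pos ht hv
  have hxpos := H.curvatureRatio_pos ht hv
  set y := x (Fin.last n) with hy
  set N := normalSq (R t) (v t y) (v₁ t y) with hN
  have hs : 0 < √N := Real.sqrt_pos.mpr hNpos
  have hsq : √N ^ 2 = N := Real.sq_sqrt hNpos.le
  have hc : 0 < (R t * √N)⁻¹ := by positivity
  refine ⟨Function.update (fun _ => (R t * √N)⁻¹) 0
    ((R t * √N)⁻¹ * curvatureRatio (R t) (v t y) (v₁ t y) (v₂ t y)),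
    update_mem_positiveCone (mul_pos hc hxpos) hc, ?_, hf.apply_update hc hxpos⟩
  have h := isPrincipalCurvatures_axial (R t ^ 2)⁻¹ (H.deriv_axial_one ht) (H.deriv_axial_two ht) x
    (N := 2 / R t * √N) (by positivity) (by
      rw [mul_pow, hsq, hρ, ← hy, hN, normalSq]
      field_simp
      ring)
  have e1 : 2 * (R t ^ 2)⁻¹ / (2 / R t * √N) = (R t * √N)⁻¹ := by
    field_simp
  rw [e1, ← hy, hρ] at h
  have e2 : (2 * (R t ^ 2)⁻¹ * (v₁ t y - (R t ^ 2)⁻¹ * (2 * y) + 2 * (R t ^ 2)⁻¹ * y) ^ 2 +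
        4 * (R t ^ 2)⁻¹ ^ 2 * (R t ^ 2 * (1 - v t y)) *
          (v₂ t y - (R t ^ 2)⁻¹ * 2 + 2 * (R t ^ 2)⁻¹)) / (2 / R t * √N) ^ 3 =
      (R t * √N)⁻¹ * curvatureRatio (R t) (v t y) (v₁ t y) (v₂ t y) := by
    have h3 : √N ^ 3 = √N * N := by rw [pow_succ, hsq, mul_comm]
    rw [curvatureRatio, ← hN, mul_pow, h3]
    have := hNpos.ne'
    field_simp
    ring
  rw [e2] at h
  exact h

lemma inwardVelocity_eq (H : IsProfileFamily a b R R' v v₁ v₂ vt) {t : ℝ} (ht : t ∈ Icc a b) {x : AmbientSpace n}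
    (hx : definingFun n R v t x = 0) :
    inwardVelocity a b (definingFun n R v) t x =
      (-R' t * (1 - v t (x (Fin.last n))) + R t * vt t (x (Fin.last n)) / 2) /
        √(normalSq (R t) (v t (x (Fin.last n))) (v₁ t (x (Fin.last n)))) := by
  have hR := H.pos t ht
  have hρ : radialSq x = R t ^ 2 * (1 - v t (x (Fin.last n))) := by
    rw [definingFun_eq] at hx
    field_simp at hx
    linarith
  have hd : HasDerivWithinAt (fun s => definingFun n R v s x)
      (-(2 * R t * R' t) / (R t ^ 2) ^ 2 * radialSq x + vt t (x (Fin.last n))) (Icc a b) t := by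
    have h1 := (((H.deriv_radius t ht).pow 2).inv (pow_pos hR 2).ne').mul_const (radialSq x)
    have h2 := (h1.add (H.deriv_time t ht (x (Fin.last n)))).sub_const 1
    have h3 : (fun s => definingFun n R v s x) =
        fun s => (R s ^ 2)⁻¹ * radialSq x + v s (x (Fin.last n)) - 1 := by
      ext s
      rw [definingFun_eq]; ring
    rw [h3]
    refine h2.congr_deriv ?_
    simp
  rw [inwardVelocity, hd.derivWithin (uniqueDiffOn_Icc H.lt t ht), H.norm_gradient ht hx, hρ]
  have hs : √(normalSq (R t) (v t (x (Fin.last n))) (v₁ t (x (Fin.last n)))) ≠ 0 := by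
    refine (Real.sqrt_pos.mpr (H.normalSq_pos ht ?_)).ne'
    have := radialSq_nonneg x
    rw [hρ] at this
    have := nonneg_of_mul_nonneg_right this (by positivity)
    linarith
  field_simp

/-- Speed and velocity share the factor 1/√N; cancelling it and multiplying by R^α leaves the scalar
hypothesis `h`. -/
lemma isSmoothSubsolution [NeZero n] (H : IsProfileFamily a b R R' v v₁ v₂ vt) {f : (Fin n → ℝ) → ℝ} (hf : IsSpeedFunction f) {α : ℝ}
    (h : ∀ t ∈ Icc a b, ∀ y, v t y ≤ 1 →
      normalSq (R t) (v t y) (v₁ t y) ^ ((1 - α) / 2) *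
        fHat f (curvatureRatio (R t) (v t y) (v₁ t y) (v₂ t y)) ^ α ≤
      R t ^ α * (-R' t * (1 - v t y) + R t * vt t y / 2)) :
    IsSmoothSubsolution f α a b (fun t => solidOfRevolution n (R t) (v t)) := by
  refine ⟨definingFun n R v, H.isSmoothFamily n, fun t ht x hx => ?_⟩
  obtain ⟨κ, hκ, hP, hfκ⟩ := H.exists_isPrincipalCurvatures hf ht hx
  refine ⟨κ, hκ, hP, ?_⟩
  have hv : v t (x (Fin.last n)) ≤ 1 := by
    rw [definingFun_eq] at hx
    have : 0 ≤ radialSq x / R t ^ 2 := div_nonneg (radialSq_nonneg x) (sq_nonneg _)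
    linarith
  have hN := H.normalSq_pos ht hv
  have hs := Real.sqrt_pos.mpr hN
  have hRα : 0 < R t ^ α := Real.rpow_pos_of_pos (H.pos t ht) _
  rw [hfκ, H.inwardVelocity_eq ht hx, speed_rpow_eq (H.pos t ht) hN
    (hf.fHat_nonneg (H.curvatureRatio_pos ht hv).le), ← div_div]
  gcongr
  rw [div_le_iff₀' hRα]
  exact h t ht _ hv

lemma isSmoothSupersolution [NeZero n] (H : IsProfileFamily a b R R' v v₁ v₂ vt) {f : (Fin n → ℝ) → ℝ} (hf : IsSpeedFunction f) {α : ℝ}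
    (h : ∀ t ∈ Icc a b, ∀ y, v t y ≤ 1 →
      R t ^ α * (-R' t * (1 - v t y) + R t * vt t y / 2) ≤
      normalSq (R t) (v t y) (v₁ t y) ^ ((1 - α) / 2) *
        fHat f (curvatureRatio (R t) (v t y) (v₁ t y) (v₂ t y)) ^ α) :
    IsSmoothSupersolution f α a b (fun t => solidOfRevolution n (R t) (v t)) := by
  refine ⟨definingFun n R v, H.isSmoothFamily n, fun t ht x hx => ?_⟩
  obtain ⟨κ, hκ, hP, hfκ⟩ := H.exists_isPrincipalCurvatures hf ht hx
  refine ⟨κ, hκ, hP, ?_⟩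
  have hv : v t (x (Fin.last n)) ≤ 1 := by
    rw [definingFun_eq] at hx
    have : 0 ≤ radialSq x / R t ^ 2 := div_nonneg (radialSq_nonneg x) (sq_nonneg _)
    linarith
  have hN := H.normalSq_pos ht hv
  have hs := Real.sqrt_pos.mpr hN
  have hRα : 0 < R t ^ α := Real.rpow_pos_of_pos (H.pos t ht) _
  rw [hfκ, H.inwardVelocity_eq ht hx, speed_rpow_eq (H.pos t ht) hN
    (hf.fHat_nonneg (H.curvatureRatio_pos ht hv).le), ← div_div]
  gcongr
  rw [le_div_iff₀' hRα]
  exact h t ht _ hv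

end IsProfileFamily

/-! ### Shrinking radii. -/

/-- The radius at time `t` of a shrinking cylinder with `R ^ (1 + α) = Z - k * (t - a)`. -/
def shrinkingRadius (α Z k a t : ℝ) : ℝ := (Z - k * (t - a)) ^ (1 / (1 + α))

section ShrinkingRadius

variable {α Z k a b t : ℝ}

lemma shrinkingRadius_pos (h : 0 < Z - k * (t - a)) : 0 < shrinkingRadius α Z k a t :=
  Real.rpow_pos_of_pos h _

lemma shrinkingRadius_rpow (hα : 0 < α) (h : 0 ≤ Z - k * (t - a)) :
    shrinkingRadius α Z k a t ^ (1 + α) = Z - k * (t - a) := by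
  rw [shrinkingRadius, ← Real.rpow_mul h, one_div_mul_cancel (by positivity), Real.rpow_one]

lemma contDiffOn_shrinkingRadius (h : ∀ t ∈ Icc a b, 0 < Z - k * (t - a)) :
    ContDiffOn ℝ ∞ (shrinkingRadius α Z k a) (Icc a b) := by
  refine ContDiffOn.rpow_const_of_ne ?_ fun t ht => (h t ht).ne'
  fun_prop

/-- The time derivative of `shrinkingRadius`. -/
def shrinkingRadiusDeriv (α Z k a t : ℝ) : ℝ :=
  -(k / (1 + α)) * shrinkingRadius α Z k a t ^ (-α)

lemma hasDerivAt_shrinkingRadius (hα : 0 < α) (h : 0 < Z - k * (t - a)) :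
    HasDerivAt (shrinkingRadius α Z k a) (shrinkingRadiusDeriv α Z k a t) t := by
  have h1 : HasDerivAt (fun t => Z - k * (t - a)) (-k) t := by
    simpa using! (((hasDerivAt_id t).sub_const a).const_mul k).const_sub Z
  refine (h1.rpow_const (p := 1 / (1 + α)) (Or.inl h.ne')).congr_deriv ?_
  rw [shrinkingRadiusDeriv, shrinkingRadius, ← Real.rpow_mul h.le]
  have : 1 / (1 + α) - 1 = 1 / (1 + α) * -α := by field_simp; ring
  rw [this]
  ring

lemma shrinkingRadius_rpow_mul_deriv (h : 0 < Z - k * (t - a)) :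
    shrinkingRadius α Z k a t ^ α * -shrinkingRadiusDeriv α Z k a t = k / (1 + α) := by
  have hR := shrinkingRadius_pos (α := α) h
  rw [shrinkingRadiusDeriv, Real.rpow_neg hR.le]
  have := (Real.rpow_pos_of_pos hR α).ne'
  field_simp

lemma shrinkingRadius_le (hα : 0 < α) (hk : 0 ≤ k) (hat : a ≤ t) (h : 0 ≤ Z - k * (t - a)) :
    shrinkingRadius α Z k a t ≤ shrinkingRadius α Z k a a := by
  refine Real.rpow_le_rpow h ?_ (by positivity)
  have := mul_nonneg hk (sub_nonneg.mpr hat)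
  simp only [sub_self, mul_zero, sub_zero]
  linarith

lemma cylinderRadius_eq {n : ℕ} [NeZero n] (f : (Fin n → ℝ) → ℝ) (α t : ℝ) :
    cylinderRadius f α t = shrinkingRadius α 1 ((1 + α) * fHat f 0 ^ α) 0 t := by
  rw [cylinderRadius, shrinkingRadius, sub_zero]

end ShrinkingRadius

/-! ### Outer bounds from balls and long ellipsoids. -/

section OuterEstimates

variable {n : ℕ} [NeZero n] {f : (Fin n → ℝ) → ℝ} {α : ℝ}

/-- The condition eR² ≤ 1 gives 1 - v ≤ N ≤ 1, and (1 - α)/2 ≤ 1 then gives N ≤ N^((1-α)/2) for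
every α > 0. Leaving k free covers both static balls (k = 0) and ellipsoids shrinking with the
cylinder. -/
lemma IsSpeedFunction.isSmoothSupersolution_ellipsoid (hf : IsSpeedFunction f) (hα : 0 < α)
    {a b Z k e y₀ : ℝ} (hab : a < b) (hk : 0 ≤ k) (hkF : k ≤ (1 + α) * fHat f 0 ^ α)
    (hZ : ∀ t ∈ Icc a b, 0 < Z - k * (t - a)) (he : 0 < e)
    (heR : e * shrinkingRadius α Z k a a ^ 2 ≤ 1) :
    IsSmoothSupersolution f α a b fun t =>
      solidOfRevolution n (shrinkingRadius α Z k a t) fun y => e * (y - y₀) ^ 2 := by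
  have H : IsProfileFamily a b (shrinkingRadius α Z k a) (shrinkingRadiusDeriv α Z k a)
      (fun _ y => e * (y - y₀) ^ 2) (fun _ y => 2 * e * (y - y₀)) (fun _ _ => 2 * e)
      (fun _ _ => 0) :=
    { lt := hab
      pos := fun t ht => shrinkingRadius_pos (hZ t ht)
      smooth_radius := contDiffOn_shrinkingRadius hZ
      deriv_radius := fun t ht => (hasDerivAt_shrinkingRadius hα (hZ t ht)).hasDerivWithinAt
      smooth := by fun_prop
      deriv_one := fun t _ y => by
        have := ((((hasDerivAt_id y).sub_const y₀).pow 2).const_mul e)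
        refine this.congr_deriv ?_
        simp; ring
      deriv_two := fun t _ y => by
        simpa using! ((hasDerivAt_id y).sub_const y₀).const_mul (2 * e)
      deriv_time := fun t _ y => hasDerivWithinAt_const _ _ _
      convex := fun _ _ _ => by positivity
      regular := fun t _ y h h0 => by
        have : y - y₀ = 0 := by simpa [he.ne'] using h0
        simp [this] at h }
  refine H.isSmoothSupersolution hf fun t ht y hy => ?_
  have hR := H.pos t ht
  have hx := H.curvatureRatio_pos ht hy
  have hN := H.normalSq_pos ht hy
  set N := normalSq (shrinkingRadius α Z k a t) (e * (y - y₀) ^ 2) (2 * e * (y - y₀)) with hNdef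
  have heR' : e * shrinkingRadius α Z k a t ^ 2 ≤ 1 := by
    refine le_trans ?_ heR
    gcongr
    exact shrinkingRadius_le hα hk ht.1 (hZ t ht).le
  have hv0 : 0 ≤ e * (y - y₀) ^ 2 := by positivity
  have hNv : N = 1 - e * (y - y₀) ^ 2 +
      (e * shrinkingRadius α Z k a t ^ 2) * (e * (y - y₀) ^ 2) := by
    rw [hNdef, normalSq]; ring
  have hN1 : N ≤ 1 := by
    rw [hNv]
    have := mul_le_mul_of_nonneg_right heR' hv0
    linarith
  have hNl : 1 - e * (y - y₀) ^ 2 ≤ N := by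
    rw [hNv]
    have : 0 ≤ (e * shrinkingRadius α Z k a t ^ 2) * (e * (y - y₀) ^ 2) := by positivity
    linarith
  have hpow : N ≤ N ^ ((1 - α) / 2) := by
    conv_lhs => rw [← Real.rpow_one N]
    exact Real.rpow_le_rpow_of_exponent_ge hN hN1 (by linarith)
  have hF0 : 0 ≤ fHat f 0 ^ α := Real.rpow_nonneg hf.fHat_zero_nonneg _
  calc shrinkingRadius α Z k a t ^ α * (-shrinkingRadiusDeriv α Z k a t *
        (1 - e * (y - y₀) ^ 2) + shrinkingRadius α Z k a t * 0 / 2)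
      = k / (1 + α) * (1 - e * (y - y₀) ^ 2) := by
        rw [← shrinkingRadius_rpow_mul_deriv (hZ t ht)]; ring
    _ ≤ fHat f 0 ^ α * N ^ ((1 - α) / 2) := by
        have h1 : k / (1 + α) ≤ fHat f 0 ^ α := by rwa [div_le_iff₀' (by positivity)]
        exact mul_le_mul h1 (hNl.trans hpow) (by linarith) hF0
    _ ≤ _ := by
        rw [mul_comm]
        gcongr
        · exact hf.fHat_zero_nonneg
        · exact hf.fHat_mono le_rfl hx.le

variable {T : ℝ} {Ω : ℝ → Set (AmbientSpace n)}

/-- A static ball about a point of the axis is an inner barrier. -/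
lemma subset_ball_of_isInnerBarrier (hf : IsSpeedFunction f) (hα : 0 < α)
    (hΩ : IsInnerBarrier f α (Ico 0 T) Ω) {s t ρ y₀ : ℝ} (hs : 0 ≤ s) (hst : s ≤ t) (htT : t < T)
    (hρ : 0 < ρ) (h : ∀ x ∈ Ω s, radialSq x + (x (Fin.last n) - y₀) ^ 2 ≤ ρ ^ 2) :
    ∀ x ∈ Ω t, radialSq x + (x (Fin.last n) - y₀) ^ 2 ≤ ρ ^ 2 := by
  rcases hst.eq_or_lt with rfl | hst
  · exact h
  have hF0 : 0 ≤ fHat f 0 ^ α := Real.rpow_nonneg hf.fHat_zero_nonneg _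
  have hR : ∀ u, shrinkingRadius α (ρ ^ (1 + α)) 0 s u = ρ := by
    intro u
    rw [shrinkingRadius, zero_mul, sub_zero, ← Real.rpow_mul hρ.le,
      mul_one_div_cancel (by positivity), Real.rpow_one]
  have hsup := hf.isSmoothSupersolution_ellipsoid hα (a := s) (b := t) (Z := ρ ^ (1 + α)) (k := 0)
    (e := (ρ ^ 2)⁻¹) (y₀ := y₀) hst le_rfl (by positivity)
    (fun u _ => by simpa using Real.rpow_pos_of_pos hρ _) (by positivity)
    (by rw [hR, inv_mul_cancel₀ (by positivity)])
  have hiff : ∀ u (x : AmbientSpace n),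
      x ∈ solidOfRevolution n (shrinkingRadius α (ρ ^ (1 + α)) 0 s u)
        (fun y => (ρ ^ 2)⁻¹ * (y - y₀) ^ 2) ↔
      radialSq x + (x (Fin.last n) - y₀) ^ 2 ≤ ρ ^ 2 := by
    intro u x
    rw [solidOfRevolution, mem_ofPred_eq, hR, inv_mul_eq_div, ← add_div, div_le_one (by positivity)]
  intro x hx
  exact (hiff t x).mp (hΩ s t _ hst (fun u hu => ⟨hs.trans hu.1, hu.2.trans_lt htT⟩) hsup
    (fun x hx => (hiff s x).mpr (h x hx)) t ⟨hst.le, le_rfl⟩ hx)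

lemma isBounded_of_isInnerBarrier (hf : IsSpeedFunction f) (hα : 0 < α)
    (hΩ : IsInnerBarrier f α (Ico 0 T) Ω) (hb : Bornology.IsBounded (Ω 0)) {t : ℝ}
    (ht : t ∈ Ico 0 T) : Bornology.IsBounded (Ω t) := by
  obtain ⟨M, hM, h⟩ := hb.exists_pos_norm_le
  refine isBounded_iff_forall_norm_le.mpr ⟨M, fun x hx => ?_⟩
  have := subset_ball_of_isInnerBarrier hf hα hΩ (y₀ := 0) le_rfl ht.1 ht.2 hM (fun x hx => by
    rw [sub_zero, ← norm_sq_eq_radialSq_add]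
    exact pow_le_pow_left₀ (norm_nonneg _) (h x hx) 2) x hx
  rw [sub_zero, ← norm_sq_eq_radialSq_add] at this
  exact (pow_le_pow_iff_left₀ (norm_nonneg _) hM.le two_ne_zero).mp this

/-- Axial half-spaces containing a bounded barrier solution persist; `σ = ±1` is the direction. -/
lemma axial_le_of_isInnerBarrier (hf : IsSpeedFunction f) (hα : 0 < α)
    (hΩ : IsInnerBarrier f α (Ico 0 T) Ω) {s t h σ : ℝ} (hs : 0 ≤ s) (hst : s ≤ t) (htT : t < T)
    (hb : Bornology.IsBounded (Ω s)) (hσ : σ ^ 2 = 1)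
    (hh : ∀ x ∈ Ω s, σ * x (Fin.last n) ≤ h) : ∀ x ∈ Ω t, σ * x (Fin.last n) ≤ h := by
  obtain ⟨M, hM, hMx⟩ := hb.exists_pos_norm_le
  have hσabs : |σ| = 1 := by
    rw [← sq_abs] at hσ
    nlinarith [abs_nonneg σ]
  intro x hx
  refine le_of_forall_pos_le_add fun η hη => ?_
  -- The ball has its pole at height h + η. A point at depth u ∈ [η, ρ] below the pole lies in it
  -- once its squared distance from the axis is at most uρ, and M² ≤ ηρ ensures this.
  set ρ := max (M + |h| + η) (max (M ^ 2 / η) 1) with hρdef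
  have hρ1 : M + |h| + η ≤ ρ := le_max_left _ _
  have hρ2 : M ^ 2 ≤ ρ * η := by
    rw [← div_le_iff₀ hη]
    exact (le_max_left _ _).trans (le_max_right _ _)
  have hρ3 : 1 ≤ ρ := (le_max_right _ _).trans (le_max_right _ _)
  have hsq : ∀ y : ℝ, (y - σ * (h + η - ρ)) ^ 2 = (σ * y - (h + η - ρ)) ^ 2 := by
    intro y
    linear_combination (-(y ^ 2) + (h + η - ρ) ^ 2) * hσ
  have := subset_ball_of_isInnerBarrier hf hα hΩ (y₀ := σ * (h + η - ρ)) hs hst htT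
    (by linarith : 0 < ρ) (fun x hx => by
      rw [hsq]
      have h1 := radialSq_le_norm_sq x
      have h2 := pow_le_pow_left₀ (norm_nonneg _) (hMx x hx) 2
      have h3 := hh x hx
      have h4 : |σ * x (Fin.last n)| ≤ M := by
        rw [abs_mul, hσabs, one_mul]
        exact (abs_last_le_norm x).trans (hMx x hx)
      have h5 := (abs_le.mp h4).1
      have h6 := le_abs_self h
      have h7 : η ≤ h + η - σ * x (Fin.last n) := by linarith
      have h8 : h + η - σ * x (Fin.last n) ≤ ρ := by linarith
      have h9 : 0 ≤ ρ := by linarith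
      nlinarith [mul_nonneg (sub_nonneg.mpr h7) h9,
        mul_nonneg (hη.le.trans h7) (sub_nonneg.mpr h8)]) x hx
  rw [hsq] at this
  have h1 := radialSq_nonneg x
  have h2 : |σ * x (Fin.last n) - (h + η - ρ)| ≤ ρ :=
    abs_le_of_sq_le_sq (by linarith) (by linarith)
  have := (abs_le.mp h2).2
  linarith

lemma subset_closedCylinder (hf : IsSpeedFunction f) (hα : 0 < α)
    (hΩ : IsInnerBarrier f α (Ico 0 T) Ω) (hb : Bornology.IsBounded (Ω 0))
    (h0 : Ω 0 ⊆ closedCylinder n 1) {t : ℝ} (ht : t ∈ Ico 0 T)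
    (htk : (1 + α) * fHat f 0 ^ α * t ≤ 1) :
    Ω t ⊆ closedCylinder n (cylinderRadius f α t) := by
  have hF0 : 0 ≤ fHat f 0 ^ α := Real.rpow_nonneg hf.fHat_zero_nonneg _
  set k := (1 + α) * fHat f 0 ^ α with hk
  have hk0 : 0 ≤ k := by positivity
  rw [cylinderRadius_eq, ← hk]
  rcases ht.1.eq_or_lt with rfl | ht0
  · simpa [shrinkingRadius] using h0
  obtain ⟨M, hM, hMx⟩ := hb.exists_pos_norm_le
  intro x hx
  change radialSq x ≤ _
  -- Starting from a radius slightly above 1 leaves room for a small e > 0 with which the ellipsoid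
  -- contains the bounded set `Ω 0`. It also keeps the radius positive when k t = 1, so the collapse
  -- time itself is covered.
  have key : ∀ Z : ℝ, 1 < Z → radialSq x ≤ shrinkingRadius α Z k 0 t ^ 2 := by
    intro Z hZ
    have hpos : ∀ u ∈ Icc 0 t, 0 < Z - k * (u - 0) := by
      intro u hu
      have := mul_le_mul_of_nonneg_left hu.2 hk0
      linarith
    set ρ := shrinkingRadius α Z k 0 0 with hρ
    have hρ1 : 1 < ρ := by
      rw [hρ, shrinkingRadius]
      simpa using Real.one_lt_rpow hZ (by positivity : 0 < 1 / (1 + α))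
    have hρ2 : 0 < 1 - (ρ ^ 2)⁻¹ := by
      rw [sub_pos]
      exact inv_lt_one_of_one_lt₀ (by nlinarith)
    set e := min (ρ ^ 2)⁻¹ ((1 - (ρ ^ 2)⁻¹) / M ^ 2) with he
    have he0 : 0 < e := lt_min (by positivity) (by positivity)
    have heM : e * M ^ 2 ≤ 1 - (ρ ^ 2)⁻¹ := by
      rw [← le_div_iff₀ (by positivity)]
      exact min_le_right _ _
    have hsup := hf.isSmoothSupersolution_ellipsoid hα (y₀ := 0) ht0 hk0 le_rfl hpos he0 (by
      rw [← hρ, ← le_div_iff₀ (by positivity), one_div]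
      exact min_le_left _ _)
    have hxt := hΩ 0 t _ ht0 (fun u hu => ⟨hu.1, hu.2.trans_lt ht.2⟩) hsup (fun z hz => by
      change radialSq z / ρ ^ 2 + e * (z (Fin.last n) - 0) ^ 2 ≤ 1
      have h1 : radialSq z ≤ 1 ^ 2 := h0 hz
      have h2 : radialSq z / ρ ^ 2 ≤ (ρ ^ 2)⁻¹ := by
        rw [div_eq_mul_inv]
        exact mul_le_of_le_one_left (by positivity) (by linarith)
      have h3 : z (Fin.last n) ^ 2 ≤ M ^ 2 :=
        sq_le_sq' (abs_le.mp ((abs_last_le_norm z).trans (hMx z hz))).1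
          (abs_le.mp ((abs_last_le_norm z).trans (hMx z hz))).2
      have h4 := mul_le_mul_of_nonneg_left h3 he0.le
      rw [sub_zero]
      linarith) t ⟨ht0.le, le_rfl⟩ hx
    have hR : 0 < shrinkingRadius α Z k 0 t := shrinkingRadius_pos (hpos t ⟨ht0.le, le_rfl⟩)
    have h5 : radialSq x / shrinkingRadius α Z k 0 t ^ 2 + e * (x (Fin.last n) - 0) ^ 2 ≤ 1 := hxt
    have h6 : 0 ≤ e * (x (Fin.last n) - 0) ^ 2 := by positivity
    rw [← div_le_one (by positivity)]
    linarith
  have hcont : Tendsto (fun Z : ℝ => shrinkingRadius α Z k 0 t ^ 2) (𝓝[>] 1)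
      (𝓝 (shrinkingRadius α 1 k 0 t ^ 2)) := by
    refine Tendsto.mono_left ?_ nhdsWithin_le_nhds
    have : Continuous fun Z : ℝ => shrinkingRadius α Z k 0 t ^ 2 := by
      unfold shrinkingRadius
      exact ((continuous_id.sub continuous_const).rpow_const
        fun _ => Or.inr (by positivity)).pow 2
    exact this.tendsto 1
  refine ge_of_tendsto hcont ?_
  filter_upwards [self_mem_nhdsWithin] with Z hZ using key Z hZ

end OuterEstimates

/-! ### Convex cap profiles with prescribed slope growth. -/

/-- Within distance 1 of q the constant η(exp(q - 1)) meets both bounds, so a partition of unity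
glues such constants. In the logarithmic variable the shift by 2 only rescales the argument of η by
exp(-2), which costs a factor e² in integrals. -/
lemma exists_smooth_majorant {η : ℝ → ℝ} (hη : AntitoneOn η (Ioi 0)) :
    ∃ μ : ℝ → ℝ, ContDiff ℝ ∞ μ ∧
      ∀ q, η (Real.exp q) ≤ μ q ∧ μ q ≤ η (Real.exp (q - 2)) := by
  have hη' : ∀ q q' : ℝ, q ≤ q' → η (Real.exp q') ≤ η (Real.exp q) := fun q q' h =>
    hη (Real.exp_pos _) (Real.exp_pos _) (Real.exp_le_exp.mpr h)
  obtain ⟨g, hg⟩ := exists_contMDiffMap_forall_mem_convex_of_local_const (n := (⊤ : ℕ∞))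
    (modelWithCornersSelf ℝ ℝ)
    (t := fun q : ℝ => Icc (η (Real.exp q)) (η (Real.exp (q - 2)))) (fun q => convex_Icc _ _)
    (fun q => ⟨η (Real.exp (q - 1)), by
      filter_upwards [Ioo_mem_nhds (sub_one_lt q) (lt_add_one q)] with q' hq'
      exact ⟨hη' _ _ hq'.1.le, hη' _ _ (by linarith [hq'.2])⟩⟩)
  exact ⟨g, contMDiff_iff_contDiff.mp g.contMDiff, fun q => hg q⟩

/-- A convex profile `V` with derivatives `p`, `p'` which is flat to the left and reaches the value
`1` before `s = 7 / 8`; the parameter `ε` measures how flat it is. -/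
structure IsCapProfile (ε : ℝ) (V p p' : ℝ → ℝ) : Prop where
  smooth : ContDiff ℝ ∞ V
  hasDerivAt : ∀ s, HasDerivAt V (p s) s
  hasDerivAt_deriv : ∀ s, HasDerivAt p (p' s) s
  pos : ∀ s, 0 < V s
  deriv_pos : ∀ s, 0 < p s
  deriv_deriv_pos : ∀ s, 0 < p' s
  le_deriv : ∀ s, V s ≤ p s
  deriv_deriv_le : ∀ s, p' s ≤ 8 * (1 + p s)
  deriv_le_of_le_one : ∀ s, V s ≤ 1 → p s ≤ 17
  le_of_le_one : ∀ s, V s ≤ 1 → s ≤ 7 / 8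
  deriv_le_exp : ∀ s, s ≤ -(1 / 2) → p s ≤ Real.exp (-(1 / (2 * ε)))

lemma IsCapProfile.deriv_le_exp_eighth {ε : ℝ} {V p p' : ℝ → ℝ} (hV : IsCapProfile ε V p p')
    (hε : 0 < ε) (hε' : ε ≤ 1 / 8) {s : ℝ} (hs : s ≤ -(1 / 2)) : p s ≤ 1 / 8 := by
  refine (hV.deriv_le_exp s hs).trans ?_
  have h1 : 4 ≤ 1 / (2 * ε) := by
    rw [le_div_iff₀ (by positivity)]
    linarith
  have h2 : (1 + 1 : ℝ) ^ 4 ≤ Real.exp 1 ^ 4 := by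
    gcongr
    linarith [Real.add_one_le_exp (1 : ℝ)]
  rw [← Real.exp_nat_mul] at h2
  have h3 : Real.exp (1 / (2 * ε)) ≥ 8 := by
    refine le_trans (le_trans (by norm_num) h2) (Real.exp_le_exp.mpr ?_)
    push_cast
    linarith
  rw [Real.exp_neg, inv_eq_one_div]
  exact one_div_le_one_div_of_le (by norm_num) h3

/-- The inverse of the slope is prescribed: ds/dp = ε/p + (1/8)/(1 + p) + C μ(log p), integrated in
q = log p as `σ`. The first term makes p defined and positive for all s, with an exponentially small
tail; the second gives p' ≤ 8(1 + p); the third gives C p' μ(log p) ≤ 1. Smallness of the integral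
of μ bounds the length of the cap. -/
lemma exists_isCapProfile_of_density {ε C : ℝ} (hε : 0 < ε) (hε' : ε ≤ 1 / 8) (hC : 0 < C)
    {μ : ℝ → ℝ} (hμ : ContDiff ℝ ∞ μ) (hμ0 : ∀ q, 0 ≤ μ q)
    (hint : ∀ z, 0 < z → IntervalIntegrable (fun z => μ (Real.log z)) volume 0 z)
    (hle : ∀ z, 0 < z → C * ∫ u in (0 : ℝ)..z, μ (Real.log u) ≤ 1 / 8)
    (hmul : ∀ z, 0 < z → C * (z * μ (Real.log z)) ≤ 1 / 2) :
    ∃ V p p' : ℝ → ℝ, IsCapProfile ε V p p' ∧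
      ∀ s, C * p' s * μ (Real.log (p s)) ≤ 1 := by
  have hcont : ∀ z, 0 < z → ContinuousAt (fun z => μ (Real.log z)) z := fun z hz =>
    hμ.continuous.continuousAt.comp (Real.continuousAt_log hz.ne')
  have hmeas : Measurable (fun z => μ (Real.log z)) :=
    hμ.continuous.measurable.comp Real.measurable_log
  set S : ℝ → ℝ := fun q =>
    ε + 1 / 8 * (Real.exp q / (1 + Real.exp q)) + C * (Real.exp q * μ q) with hS
  set σ : ℝ → ℝ := fun q => ε * q + 1 / 8 * Real.log (1 + Real.exp q) +
    C * ∫ u in (0 : ℝ)..Real.exp q, μ (Real.log u) with hσ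
  have hSsm : ContDiff ℝ ∞ S := by
    have h1 : ∀ q, 1 + Real.exp q ≠ 0 := fun q => by positivity
    have := Real.contDiff_exp (n := ∞)
    exact (contDiff_const.add (contDiff_const.mul
      (this.div (contDiff_const.add this) h1))).add (contDiff_const.mul (this.mul hμ))
  have hSε : ∀ q, ε ≤ S q := by
    intro q
    have h1 := hμ0 q
    have : 0 ≤ 1 / 8 * (Real.exp q / (1 + Real.exp q)) + C * (Real.exp q * μ q) := by positivity
    simp only [hS]
    linarith
  have hSpos : ∀ q, 0 < S q := fun q => hε.trans_le (hSε q)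
  have hσd : ∀ q, HasDerivAt σ (S q) q := by
    intro q
    have hq := Real.exp_pos q
    have h1 : HasDerivAt (fun z => ∫ u in (0 : ℝ)..z, μ (Real.log u)) (μ (Real.log (Real.exp q)))
        (Real.exp q) :=
      intervalIntegral.integral_hasDerivAt_right (hint _ hq)
        hmeas.stronglyMeasurable.stronglyMeasurableAtFilter (hcont _ hq)
    have h2 := (h1.comp q (Real.hasDerivAt_exp q)).const_mul C
    have h3 := ((((Real.hasDerivAt_exp q).const_add 1).log (by positivity)).const_mul (1 / 8 : ℝ))
    have h4 := (((hasDerivAt_id q).const_mul ε).add h3).add h2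
    refine h4.congr_deriv ?_
    simp only [hS, Real.log_exp]
    ring
  have hσsm : ContDiff ℝ ∞ σ := by
    rw [contDiff_infty_iff_deriv]
    refine ⟨fun q => (hσd q).differentiableAt, ?_⟩
    have : deriv σ = S := funext fun q => (hσd q).deriv
    rwa [this]
  have hσmono : StrictMono σ := strictMono_of_deriv_pos fun q => by
    rw [(hσd q).deriv]; exact hSpos q
  have hI0 : ∀ z, 0 < z → 0 ≤ ∫ u in (0 : ℝ)..z, μ (Real.log u) := fun z hz =>
    intervalIntegral.integral_nonneg hz.le fun u _ => hμ0 _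
  have hσlow : ∀ q, ε * q + 1 / 8 * Real.log (1 + Real.exp q) ≤ σ q := by
    intro q
    have := mul_nonneg hC.le (hI0 _ (Real.exp_pos q))
    simp only [hσ]
    linarith
  have hσupp : ∀ q, σ q ≤ ε * q + 1 / 8 * Real.log (1 + Real.exp q) + 1 / 8 := by
    intro q
    have := hle _ (Real.exp_pos q)
    simp only [hσ]
    linarith
  have hlog0 : ∀ q, 0 ≤ Real.log (1 + Real.exp q) := fun q =>
    Real.log_nonneg (by linarith [Real.exp_pos q])
  have hsurj : Function.Surjective σ := by
    refine hσsm.continuous.surjective ?_ ?_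
    · refine tendsto_atTop_mono (fun q => ?_) (tendsto_id.const_mul_atTop hε)
      have h1 := hσlow q
      have h2 := hlog0 q
      simp only [id]
      linarith
    · have hlin : Tendsto (fun q => ε * q + 1 / 4) atBot atBot :=
        tendsto_atBot_add_const_right _ _ (tendsto_id.const_mul_atBot hε)
      suffices hev : ∀ᶠ q in atBot, σ q ≤ ε * q + 1 / 4 from tendsto_atBot_mono' _ hev hlin
      filter_upwards [eventually_le_atBot 0] with q hq
      have h1 := hσupp q
      have h2 := Real.log_le_sub_one_of_pos (show 0 < 1 + Real.exp q by positivity)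
      have h3 := Real.exp_le_one_iff.mpr hq
      linarith
  set e : ℝ ≃ₜ ℝ := (hσmono.orderIsoOfSurjective σ hsurj).toHomeomorph with he
  have heσ : ∀ q, e q = σ q := fun q => rfl
  set Q : ℝ → ℝ := fun s => e.symm s with hQ
  have hσQ : ∀ s, σ (Q s) = s := fun s => by rw [← heσ]; exact e.apply_symm_apply s
  have hQsm : ContDiff ℝ ∞ Q :=
    e.contDiff_symm_deriv (f' := S) (fun q => (hSpos q).ne') hσd hσsm
  have hQd : ∀ s, HasDerivAt Q (S (Q s))⁻¹ s := fun s =>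
    (hσd (Q s)).of_local_left_inverse hQsm.continuous.continuousAt (hSpos _).ne'
      (Eventually.of_forall hσQ)
  -- Here dΨ/dz = z ds/dz, so V = Ψ(p) satisfies V' = p.
  set Ψ : ℝ → ℝ := fun z => ε * z + 1 / 8 * (z - Real.log (1 + z)) +
    C * ∫ u in (0 : ℝ)..z, u * μ (Real.log u) with hΨ
  have hint' : ∀ z, 0 < z → IntervalIntegrable (fun u => u * μ (Real.log u)) volume 0 z :=
    fun z hz => (hint z hz).continuousOn_mul continuousOn_id
  have hΨd : ∀ q, HasDerivAt Ψ (S q) (Real.exp q) := by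
    intro q
    have hq := Real.exp_pos q
    have h1 : HasDerivAt (fun z => ∫ u in (0 : ℝ)..z, u * μ (Real.log u))
        (Real.exp q * μ (Real.log (Real.exp q))) (Real.exp q) :=
      intervalIntegral.integral_hasDerivAt_right (hint' _ hq)
        (measurable_id.mul hmeas).stronglyMeasurable.stronglyMeasurableAtFilter
        (continuousAt_id.mul (hcont _ hq))
    have h3 := (((hasDerivAt_id (Real.exp q)).const_add 1).log
      (by simp only [id]; positivity))
    have h4 := (((hasDerivAt_id (Real.exp q)).const_mul ε).add
      (((hasDerivAt_id (Real.exp q)).sub h3).const_mul (1 / 8 : ℝ))).add (h1.const_mul C)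
    refine h4.congr_deriv ?_
    have : (1 : ℝ) + Real.exp q ≠ 0 := by positivity
    simp only [hS, Real.log_exp, id]
    field_simp
    ring
  set p : ℝ → ℝ := fun s => Real.exp (Q s) with hp
  have hp0 : ∀ s, 0 < p s := fun s => Real.exp_pos _
  have hpd : ∀ s, HasDerivAt p (p s * (S (Q s))⁻¹) s := fun s => (hQd s).exp
  have hpsm : ContDiff ℝ ∞ p := hQsm.exp
  have hVd : ∀ s, HasDerivAt (fun s => Ψ (p s)) (p s) s := by
    intro s
    refine ((hΨd (Q s)).comp s (hpd s)).congr_deriv ?_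
    have := (hSpos (Q s)).ne'
    field_simp
  have hJ0 : ∀ z, 0 < z → 0 ≤ ∫ u in (0 : ℝ)..z, u * μ (Real.log u) := fun z hz =>
    intervalIntegral.integral_nonneg hz.le fun u hu => mul_nonneg hu.1 (hμ0 _)
  have hJ1 : ∀ z, 0 < z → C * ∫ u in (0 : ℝ)..z, u * μ (Real.log u) ≤ z / 2 := by
    intro z hz
    rw [← intervalIntegral.integral_const_mul]
    calc ∫ u in (0 : ℝ)..z, C * (u * μ (Real.log u)) ≤ ∫ u in (0 : ℝ)..z, (1 / 2 : ℝ) := by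
          refine intervalIntegral.integral_mono_on_of_le_Ioo hz.le ((hint' z hz).const_mul C)
            intervalIntegrable_const fun u hu => hmul u hu.1
      _ = z / 2 := by simp; ring
  have hlogle : ∀ z, 0 < z → Real.log (1 + z) ≤ z := fun z hz => by
    have := Real.log_le_sub_one_of_pos (show 0 < 1 + z by positivity)
    linarith
  -- The logarithm satisfies log(1 + p) ≤ (1 + p)/2, so (p - log(1 + p))/8 ≤ 1 forces p ≤ 17.
  have h17 : ∀ s, Ψ (p s) ≤ 1 → p s ≤ 17 := by
    intro s hs
    have h1 := mul_nonneg hC.le (hJ0 _ (hp0 s))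
    have h2 := mul_pos hε (hp0 s)
    have h3 := Real.log_le_sub_one_of_pos (show 0 < (1 + p s) / 2 by linarith [hp0 s])
    have h4 : Real.log ((1 + p s) / 2) = Real.log (1 + p s) - Real.log 2 :=
      Real.log_div (by linarith [hp0 s]) two_ne_zero
    have h5 := Real.log_le_sub_one_of_pos (show (0 : ℝ) < 2 by norm_num)
    simp only [hΨ] at hs
    linarith
  refine ⟨fun s => Ψ (p s), p, fun s => p s * (S (Q s))⁻¹,
    ⟨?_, hVd, hpd, fun s => ?_, hp0, fun s => mul_pos (hp0 s) (inv_pos.mpr (hSpos _)),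
      fun s => ?_, fun s => ?_, h17, fun s hs => ?_, fun s hs => ?_⟩, fun s => ?_⟩
  · rw [contDiff_infty_iff_deriv]
    refine ⟨fun s => (hVd s).differentiableAt, ?_⟩
    have : deriv (fun s => Ψ (p s)) = p := funext fun s => (hVd s).deriv
    rwa [this]
  · have h1 := mul_nonneg hC.le (hJ0 _ (hp0 s))
    have h2 := mul_pos hε (hp0 s)
    have h3 := hlogle _ (hp0 s)
    simp only [hΨ]
    linarith
  · have h1 := hJ1 _ (hp0 s)
    have h2 := mul_le_mul_of_nonneg_right hε' (hp0 s).le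
    have h3 : 0 ≤ Real.log (1 + p s) := Real.log_nonneg (by linarith [hp0 s])
    simp only [hΨ]
    linarith [hp0 s]
  · rw [← div_eq_mul_inv, div_le_iff₀ (hSpos _)]
    have h1 : 1 / 8 * (p s / (1 + p s)) ≤ S (Q s) := by
      have := mul_nonneg hC.le (mul_nonneg (hp0 s).le (hμ0 (Q s)))
      simp only [hS]
      change 1 / 8 * (p s / (1 + p s)) ≤ ε + 1 / 8 * (p s / (1 + p s)) + C * (p s * μ (Q s))
      linarith
    have h2 : 0 < 1 + p s := by linarith [hp0 s]
    calc p s = 8 * (1 + p s) * (1 / 8 * (p s / (1 + p s))) := by field_simp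
      _ ≤ _ := by gcongr
  -- Since log 18 ≤ 3 and ε ≤ 1/8, the three terms of `σ` add up to at most 3/8 + 3/8 + 1/8 = 7/8.
  · have h1 := hσupp (Q s)
    rw [hσQ] at h1
    have h2 : p s ≤ 17 := h17 s hs
    have h3 : Real.log (1 + p s) ≤ 3 := by
      rw [Real.log_le_iff_le_exp (by linarith [hp0 s])]
      have h4 : (2.7 : ℝ) ^ 3 ≤ Real.exp 1 ^ 3 := by
        gcongr
        linarith [Real.exp_one_gt_d9]
      rw [← Real.exp_nat_mul] at h4
      norm_num at h4 ⊢
      linarith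
    have h4 : Q s ≤ Real.log (1 + p s) := by
      rw [Real.le_log_iff_exp_le (by linarith [hp0 s])]
      change p s ≤ _
      linarith
    change s ≤ ε * Q s + 1 / 8 * Real.log (1 + p s) + 1 / 8 at h1
    have h5 : ε * Q s ≤ 1 / 8 * 3 :=
      (mul_le_mul_of_nonneg_left (h4.trans h3) hε.le).trans
        (mul_le_mul_of_nonneg_right hε' (by norm_num))
    linarith
  · have h1 := hσlow (Q s)
    rw [hσQ] at h1
    have h2 := hlog0 (Q s)
    refine Real.exp_le_exp.mpr ?_
    have h3 : ε * Q s ≤ -(1 / 2) := by linarith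
    rw [← le_div_iff₀' hε] at h3
    refine h3.trans_eq ?_
    field_simp
  · have h1 : C * (p s * μ (Q s)) ≤ S (Q s) := by
      have := hp0 s
      have h2 : 0 ≤ 1 / 8 * (p s / (1 + p s)) := by positivity
      simp only [hS]
      change C * (p s * μ (Q s)) ≤ ε + 1 / 8 * (p s / (1 + p s)) + C * (p s * μ (Q s))
      linarith
    have h2 : Real.log (p s) = Q s := Real.log_exp _
    rw [h2]
    calc C * (p s * (S (Q s))⁻¹) * μ (Q s) = C * (p s * μ (Q s)) / S (Q s) := by ring
      _ ≤ 1 := (div_le_one (hSpos _)).mpr h1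

/-! ### From the integral condition to cap profiles. -/

section GInv

variable {n : ℕ} [NeZero n] {f : (Fin n → ℝ) → ℝ} {α : ℝ}

lemma gInv_mono : Monotone (gInv f α) := fun _ _ h =>
  iInf_mono fun _ => iInf_mono' fun hx => ⟨⟨hx.1, h.trans hx.2⟩, le_rfl⟩

lemma gFun_lt_of_lt_gInv {x z : ℝ} (hx : 0 ≤ x) (h : ENNReal.ofReal x < gInv f α z) :
    gFun f α x < z := by
  by_contra! hz
  exact h.not_ge (iInf₂_le x ⟨hx, hz⟩)

/-- The density `1 / g⁻¹` near zero, cut off so that its integral is small. -/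
lemma CylindricalDegeneracy.exists_density (h : CylindricalDegeneracy f α) {δ : ℝ} (hδ : 0 < δ) :
    ∃ (z₁ : ℝ) (η : ℝ → ℝ), 0 < z₁ ∧ (∀ z, 0 ≤ η z) ∧ AntitoneOn η (Ioi 0) ∧ Integrable η ∧
      ∫ z, η z ≤ δ ∧ ∀ z ∈ Ioo 0 z₁, ENNReal.ofReal (η z) = (gInv f α z)⁻¹ := by
  set k : ℝ → ℝ≥0∞ := fun z => (gInv f α z)⁻¹ with hk
  have hanti : Antitone k := fun a b hab => ENNReal.inv_le_inv.mpr (gInv_mono hab)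
  have hkm : Measurable k := hanti.measurable
  obtain ⟨d, hd, hdlt⟩ := exists_pos_setLIntegral_lt_of_measure_lt (h : _ < ⊤).ne
    (ε := ENNReal.ofReal δ) (by simpa using hδ)
  obtain ⟨z₁, hz0, hzd⟩ : ∃ z₁ : ℝ, z₁ ∈ Ioo (0 : ℝ) 1 ∧ ENNReal.ofReal z₁ < d := by
    have ht : Tendsto ENNReal.ofReal (𝓝[>] 0) (𝓝 0) := by
      have := (ENNReal.continuous_ofReal.tendsto 0).mono_left
        (nhdsWithin_le_nhds (s := Ioi (0 : ℝ)))
      simpa using this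
    obtain ⟨z, h1, h2⟩ := ((ht.eventually (gt_mem_nhds hd)).and (Ioo_mem_nhdsGT one_pos)).exists
    exact ⟨z, h2, h1⟩
  have hlt : ∫⁻ z in Ioo 0 z₁, k z < ENNReal.ofReal δ := by
    have h1 := hdlt (Ioo 0 z₁) ((Measure.restrict_apply_le _ _).trans_lt (by simpa using hzd))
    rwa [Measure.restrict_restrict measurableSet_Ioo,
      inter_eq_left.mpr (Ioo_subset_Ioo_right hz0.2.le)] at h1
  have hne : ∫⁻ z in Ioo 0 z₁, k z ≠ ⊤ := (hlt.trans ENNReal.ofReal_lt_top).ne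
  -- An infinite value at z would, by monotonicity, be infinite on all of (0, z) and make the
  -- integral diverge.
  have hfin : ∀ z ∈ Ioo 0 z₁, k z ≠ ⊤ := by
    intro z hz htop
    have h1 : ∫⁻ u in Ioo 0 z, (⊤ : ℝ≥0∞) ≤ ∫⁻ u in Ioo 0 z₁, k u :=
      (setLIntegral_mono hkm fun u hu => htop ▸ hanti hu.2.le).trans
        (lintegral_mono_set (Ioo_subset_Ioo_right hz.2.le))
    rw [setLIntegral_const, Real.volume_Ioo, sub_zero,
      ENNReal.top_mul (by simpa using hz.1)] at h1
    exact hne (top_le_iff.mp h1)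
  refine ⟨z₁, (Ioo 0 z₁).indicator fun z => (k z).toReal, hz0.1,
    fun z => indicator_nonneg (fun _ _ => ENNReal.toReal_nonneg) _, ?_, ?_, ?_, ?_⟩
  · intro a ha b hb hab
    by_cases hb1 : b < z₁
    · rw [indicator_of_mem (show b ∈ Ioo 0 z₁ from ⟨hb, hb1⟩),
        indicator_of_mem (show a ∈ Ioo 0 z₁ from ⟨ha, hab.trans_lt hb1⟩)]
      exact ENNReal.toReal_mono (hfin _ ⟨ha, hab.trans_lt hb1⟩) (hanti hab)
    · rw [indicator_of_notMem fun h => hb1 h.2]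
      exact indicator_nonneg (fun _ _ => ENNReal.toReal_nonneg) _
  · rw [integrable_indicator_iff measurableSet_Ioo]
    exact integrable_toReal_of_lintegral_ne_top hkm.aemeasurable hne
  · rw [integral_indicator measurableSet_Ioo, integral_toReal hkm.aemeasurable
      ((ae_restrict_iff' measurableSet_Ioo).mpr
        (Eventually.of_forall fun z hz => (hfin z hz).lt_top))]
    exact ENNReal.toReal_le_of_le_ofReal hδ.le hlt.le
  · intro z hz
    rw [indicator_of_mem hz, ENNReal.ofReal_toReal (hfin z hz)]

/-- The cap construction is applied to a smooth majorant of 1/g⁻¹, so that C p' μ(log p) ≤ 1 reads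
1000 p' ≤ g⁻¹(p). The total mass 10⁻⁶ of the density absorbs both C = 1000 and the factor e² ≤ 8
lost to the majorant. Neither the density nor `z₁` depends on ε. -/
lemma CylindricalDegeneracy.exists_isCapProfile (h : CylindricalDegeneracy f α) :
    ∃ z₁ : ℝ, 0 < z₁ ∧ (∀ z ∈ Ioo 0 z₁, ENNReal.ofReal (1000 * z) ≤ gInv f α z) ∧
      ∀ ε, 0 < ε → ε ≤ 1 / 8 → ∃ V p p' : ℝ → ℝ, IsCapProfile ε V p p' ∧
        ∀ s, p s < z₁ → ENNReal.ofReal (1000 * p' s) ≤ gInv f α (p s) := by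
  obtain ⟨z₁, η, hz₁, hη0, hηa, hηi, hηδ, hη⟩ := h.exists_density (δ := 1 / 10 ^ 6) (by norm_num)
  have hbound : ∀ z ∈ Ioo 0 z₁, ∀ c, 0 ≤ c → 1000 * c * η z ≤ 1 →
      ENNReal.ofReal (1000 * c) ≤ gInv f α z := by
    intro z hz c hc hle
    rw [← inv_inv (gInv f α z), ← hη z hz, ENNReal.le_inv_iff_mul_le,
      ← ENNReal.ofReal_mul (by positivity)]
    exact ENNReal.ofReal_le_one.mpr hle
  have hII : ∀ a b : ℝ, IntervalIntegrable η volume a b := fun a b => hηi.intervalIntegrable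
  have hIle : ∀ a b : ℝ, a ≤ b → ∫ z in a..b, η z ≤ 1 / 10 ^ 6 := by
    intro a b hab
    rw [intervalIntegral.integral_of_le hab]
    exact (setIntegral_le_integral hηi (Eventually.of_forall hη0)).trans hηδ
  -- As η is antitone, (z/2) η(z) is at most the integral of η over [z/2, z].
  have hzη : ∀ z, 0 < z → z * η z ≤ 2 / 10 ^ 6 := by
    intro z hz
    have h1 : ∫ u in (z / 2)..z, η z ≤ ∫ u in (z / 2)..z, η u := by
      refine intervalIntegral.integral_mono_on (by linarith) intervalIntegrable_const (hII _ _)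
        fun u hu => hηa (mem_Ioi.mpr ?_) (mem_Ioi.mpr hz) hu.2
      linarith [hu.1]
    have h2 := hIle (z / 2) z (by linarith)
    rw [intervalIntegral.integral_const, smul_eq_mul] at h1
    linarith
  have he2 : Real.exp 2 ≤ 8 := by
    have h1 : Real.exp 2 = Real.exp 1 * Real.exp 1 := by rw [← Real.exp_add]; norm_num
    have h2 := Real.exp_one_lt_d9
    have h3 := Real.exp_pos 1
    nlinarith
  obtain ⟨μ, hμ, hμη⟩ := exists_smooth_majorant hηa
  have hμ0 : ∀ q, 0 ≤ μ q := fun q => (hη0 _).trans (hμη q).1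
  have hμle : ∀ z, 0 < z → μ (Real.log z) ≤ η (Real.exp (-2) * z) := by
    intro z hz
    have := (hμη (Real.log z)).2
    rwa [sub_eq_neg_add, Real.exp_add, Real.exp_log hz] at this
  have hcomp : Integrable fun z => η (Real.exp (-2) * z) :=
    hηi.comp_mul_left' (Real.exp_pos _).ne'
  have hmeas : Measurable (fun z => μ (Real.log z)) :=
    hμ.continuous.measurable.comp Real.measurable_log
  have hint : ∀ z, 0 < z → IntervalIntegrable (fun z => μ (Real.log z)) volume 0 z := by
    intro z hz
    rw [intervalIntegrable_iff_integrableOn_Ioc_of_le hz.le]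
    refine hcomp.integrableOn.mono' hmeas.aestronglyMeasurable
      ((ae_restrict_iff' measurableSet_Ioc).mpr (Eventually.of_forall fun u hu => ?_))
    rw [Real.norm_of_nonneg (hμ0 _)]
    exact hμle u hu.1
  have hle : ∀ z, 0 < z → 1000 * ∫ u in (0 : ℝ)..z, μ (Real.log u) ≤ 1 / 8 := by
    intro z hz
    have h1 : ∫ u in (0 : ℝ)..z, μ (Real.log u) ≤ ∫ u in (0 : ℝ)..z, η (Real.exp (-2) * u) :=
      intervalIntegral.integral_mono_on_of_le_Ioo hz.le (hint z hz) hcomp.intervalIntegrable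
        fun u hu => hμle u hu.1
    rw [intervalIntegral.integral_comp_mul_left η (Real.exp_pos _).ne', mul_zero, smul_eq_mul,
      Real.exp_neg, inv_inv, ← Real.exp_neg] at h1
    have h2 := hIle 0 (Real.exp (-2) * z) (by positivity)
    have h3 := mul_le_mul_of_nonneg_left h2 (Real.exp_pos 2).le
    linarith
  have hmul : ∀ z, 0 < z → 1000 * (z * μ (Real.log z)) ≤ 1 / 2 := by
    intro z hz
    have h1 := hzη (Real.exp (-2) * z) (by positivity)
    have h2 := mul_le_mul_of_nonneg_left (hμle z hz) hz.le
    have h3 : z * η (Real.exp (-2) * z) =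
        Real.exp 2 * (Real.exp (-2) * z * η (Real.exp (-2) * z)) := by
      rw [← mul_assoc, ← mul_assoc, ← Real.exp_add]; norm_num
    have h4 := mul_le_mul_of_nonneg_left h1 (Real.exp_pos 2).le
    linarith
  refine ⟨z₁, hz₁, fun z hz => hbound z hz z hz.1.le ?_, fun ε hε hε' => ?_⟩
  · have := hzη z hz.1
    linarith
  · obtain ⟨V, p, p', hV, hp⟩ := exists_isCapProfile_of_density hε hε' (C := 1000) (by norm_num)
      hμ hμ0 hint hle hmul
    refine ⟨V, p, p', hV, fun s hs => hbound _ ⟨hV.deriv_pos s, hs⟩ _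
        (hV.deriv_deriv_pos s).le ((mul_le_mul_of_nonneg_left ?_ ?_).trans (hp s))⟩
    · have := (hμη (Real.log (p s))).1
      rwa [Real.exp_log (hV.deriv_pos s)] at this
    · have := hV.deriv_deriv_pos s
      positivity

end GInv

/-! ### The cap as a subsolution, and one step of persistence. -/

lemma exists_rpow_le_one_add (e : ℝ) :
    ∃ Λ : ℝ, 0 < Λ ∧ ∀ z ∈ Icc (1 / 64 : ℝ) 80, z ^ e ≤ 1 + Λ * |z - 1| := by
  refine ⟨(|e| + 1) * 64 * Real.exp (|e| * 64 * 80), by positivity, fun z hz => ?_⟩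
  have hz0 : 0 < z := by linarith [hz.1]
  have hlog : |Real.log z| ≤ 64 * |z - 1| := by
    have h1 := Real.log_le_sub_one_of_pos hz0
    have h2 := Real.one_sub_inv_le_log_of_pos hz0
    have h3 : 1 - z⁻¹ = (z - 1) / z := by field_simp
    have h4 : |(z - 1) / z| ≤ 64 * |z - 1| := by
      rw [abs_div, abs_of_pos hz0, div_le_iff₀ hz0]
      nlinarith [abs_nonneg (z - 1), hz.1]
    rw [h3] at h2
    have h5 := neg_abs_le ((z - 1) / z)
    have h6 := le_abs_self (z - 1)
    refine abs_le.mpr ⟨by linarith, by linarith [abs_nonneg (z - 1)]⟩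
  have habs : |z - 1| ≤ 80 := abs_le.mpr ⟨by linarith [hz.1], by linarith [hz.2]⟩
  rw [Real.rpow_def_of_pos hz0]
  set t := Real.log z * e with ht
  have ht1 : |t| ≤ |e| * 64 * |z - 1| := by
    rw [ht, abs_mul]
    nlinarith [mul_le_mul_of_nonneg_right hlog (abs_nonneg e)]
  have ht2 : |t| ≤ |e| * 64 * 80 := ht1.trans (by gcongr)
  have h1 : Real.exp t ≤ 1 + t * Real.exp t := by
    have h2 := Real.add_one_le_exp (-t)
    have h3 := mul_le_mul_of_nonneg_right h2 (Real.exp_pos t).le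
    rw [← Real.exp_add, neg_add_cancel, Real.exp_zero] at h3
    linarith
  calc Real.exp t ≤ 1 + t * Real.exp t := h1
    _ ≤ 1 + |t| * Real.exp |t| := by
      have h2 := Real.exp_le_exp.mpr (le_abs_self t)
      have h3 := mul_le_mul_of_nonneg_right (le_abs_self t) (Real.exp_pos t).le
      have h4 := mul_le_mul_of_nonneg_left h2 (abs_nonneg t)
      linarith
    _ ≤ 1 + (|e| + 1) * 64 * |z - 1| * Real.exp (|e| * 64 * 80) := by
      gcongr
      refine ht1.trans ?_
      gcongr
      linarith
    _ = _ := by ring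

section InnerEstimates

variable {n : ℕ} [NeZero n] {f : (Fin n → ℝ) → ℝ} {α : ℝ}

/-- The differential inequality for the cap, in terms of the slopes `P ≥ Q` of its two summands. -/
lemma IsSpeedFunction.exists_cap_inequality (hf : IsSpeedFunction f) (hα : 0 < α) {z₁ : ℝ}
    (hz₁ : 0 < z₁) (hz : ∀ z ∈ Ioo 0 z₁, ENNReal.ofReal (1000 * z) ≤ gInv f α z) :
    ∃ c : ℝ, 0 < c ∧ ∀ P Q P' Q' v : ℝ, 0 < Q → Q ≤ 1 / 8 → Q ≤ P → P ≤ 17 → 0 < P' → 0 < Q' →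
      0 < v → v ≤ 1 → v ≤ P + Q → P' ≤ 8 * (1 + P) → Q' ≤ 8 * (1 + Q) →
      (P < z₁ → ENNReal.ofReal (1000 * P') ≤ gInv f α P) →
      (Q < z₁ → ENNReal.ofReal (1000 * Q') ≤ gInv f α Q) →
      (1 - v + (P - Q) ^ 2 / 4) ^ ((1 - α) / 2) *
        fHat f (((P - Q) ^ 2 / 4 + (P' + Q') * (1 - v) / 2) / (1 - v + (P - Q) ^ 2 / 4)) ^ α ≤
      fHat f 0 ^ α * (1 - v) + c * (P + Q) / 2 := by
  obtain ⟨Λ, hΛ, hpow⟩ := exists_rpow_le_one_add ((1 - α) / 2)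
  set F := fHat f 0 ^ α with hF
  have hF0 : 0 ≤ F := Real.rpow_nonneg hf.fHat_zero_nonneg _
  set Y := fHat f 10000 ^ α with hY
  have hY0 : 0 ≤ Y := Real.rpow_nonneg (hf.fHat_nonneg (by norm_num)) _
  -- The first summand absorbs the errors of order P when P < z₁. The second covers P ≥ z₁, where
  -- the left side is merely bounded by (1 + 80Λ)Y.
  refine ⟨2 * (1 + 7 * Λ * F + 119 * Λ + 2 * F) + 2 * ((1 + 80 * Λ) * Y / z₁), by positivity, ?_⟩
  intro P Q P' Q' v hQ hQ8 hQP hP17 hP' hQ' hv0 hv1 hvPQ hP'le hQ'le hgP hgQ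
  have hP : 0 < P := hQ.trans_le hQP
  have hd0 : 0 ≤ P - Q := by linarith
  have hd2 : (P - Q) ^ 2 ≤ P ^ 2 := by gcongr; linarith
  set N := 1 - v + (P - Q) ^ 2 / 4 with hN
  have hP2 : P ^ 2 ≤ 17 * P := by
    rw [sq]
    exact mul_le_mul_of_nonneg_right hP17 hP.le
  have hd20 := sq_nonneg (P - Q)
  -- If v > 1/2, then P + Q ≥ v and Q ≤ 1/8 force P - Q ≥ 1/4, so the gradient term keeps N away
  -- from 0.
  have hN1 : 1 / 64 ≤ N := by
    rcases le_or_gt v (1 / 2) with h | h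
    · linarith
    · have : 1 / 4 ≤ P - Q := by linarith
      have := pow_le_pow_left₀ (by norm_num) this 2
      linarith
  have hN2 : N ≤ 80 := by linarith
  have hN0 : 0 < N := by linarith
  have hNabs : |N - 1| ≤ 7 * P := abs_le.mpr ⟨by linarith, by linarith⟩
  have hNabs' : |N - 1| ≤ 80 := abs_le.mpr ⟨by linarith, by linarith⟩
  have hNe0 : 0 ≤ N ^ ((1 - α) / 2) := Real.rpow_nonneg hN0.le _
  have hNe := hpow N ⟨hN1, hN2⟩
  set x := ((P - Q) ^ 2 / 4 + (P' + Q') * (1 - v) / 2) / N with hx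
  have hnum0 : 0 ≤ (P - Q) ^ 2 / 4 + (P' + Q') * (1 - v) / 2 := by
    have := mul_nonneg (add_pos hP' hQ').le (sub_nonneg.mpr hv1)
    positivity
  have hx0 : 0 ≤ x := div_nonneg hnum0 hN0.le
  have hxle : x ≤ 64 * (P ^ 2 / 4 + (P' + Q') / 2) := by
    rw [hx, div_le_iff₀ hN0]
    have h1 : (P - Q) ^ 2 / 4 + (P' + Q') * (1 - v) / 2 ≤ P ^ 2 / 4 + (P' + Q') / 2 := by
      have := mul_nonneg (add_pos hP' hQ').le hv0.le
      linarith
    have h2 : 0 ≤ P ^ 2 / 4 + (P' + Q') / 2 := by positivity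
    have h3 := mul_nonneg h2 (sub_nonneg.mpr hN1)
    linarith
  have hfx0 : 0 ≤ fHat f x ^ α := Real.rpow_nonneg (hf.fHat_nonneg hx0) _
  have hv1' : 0 ≤ 1 - v := by linarith
  have hquot : 0 ≤ (1 + 80 * Λ) * Y / z₁ := by positivity
  rcases lt_or_ge P z₁ with hPz | hPz
  · have hG1 := hgP hPz
    have hG2 := (hgQ (hQP.trans_lt hPz)).trans (gInv_mono hQP)
    have hG3 := hz P ⟨hP, hPz⟩
    -- The bound on x gives x ≤ 272P + 32P' + 32Q', while 1000P, 1000P' and 1000Q' are each at most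
    -- g⁻¹(P); the coefficients add up to 336 < 1000.
    have hlt : ENNReal.ofReal x < gInv f α P := by
      by_contra! hle
      have h1 := (ENNReal.ofReal_le_ofReal_iff hx0).mp (hG1.trans hle)
      have h2 := (ENNReal.ofReal_le_ofReal_iff hx0).mp (hG2.trans hle)
      have h3 := (ENNReal.ofReal_le_ofReal_iff hx0).mp (hG3.trans hle)
      linarith
    have hg := gFun_lt_of_lt_gInv hx0 hlt
    rw [gFun, ← hF] at hg
    have h1 : N ^ ((1 - α) / 2) ≤ 1 + Λ * (7 * P) := hNe.trans (by gcongr)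
    have h2 : N ^ ((1 - α) / 2) * fHat f x ^ α ≤ (1 + Λ * (7 * P)) * (F + P) :=
      mul_le_mul h1 (by linarith) hfx0 (by positivity)
    have h3 : F * v ≤ F * (2 * P) := mul_le_mul_of_nonneg_left (by linarith) hF0
    have h4 : Λ * (7 * P) * P ≤ Λ * (7 * P) * 17 := by gcongr
    have h5 : (2 * (1 + 7 * Λ * F + 119 * Λ + 2 * F)) * P ≤
        (2 * (1 + 7 * Λ * F + 119 * Λ + 2 * F) + 2 * ((1 + 80 * Λ) * Y / z₁)) * (P + Q) := by
      gcongr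
      · linarith
      · linarith
    linarith
  -- From P ≤ 17 follow P' ≤ 144 and Q' ≤ 9, which bound x by 9520.
  · have hx1 : x ≤ 10000 := by linarith
    have h1 : N ^ ((1 - α) / 2) ≤ 1 + 80 * Λ := by
      have := mul_le_mul_of_nonneg_left hNabs' hΛ.le
      linarith
    have h2 : fHat f x ^ α ≤ Y :=
      Real.rpow_le_rpow (hf.fHat_nonneg hx0) (hf.fHat_mono hx0 hx1) hα.le
    have h3 : N ^ ((1 - α) / 2) * fHat f x ^ α ≤ (1 + 80 * Λ) * Y :=
      mul_le_mul h1 h2 hfx0 (by positivity)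
    have h4 : (1 + 80 * Λ) * Y = (1 + 80 * Λ) * Y / z₁ * z₁ := by field_simp
    have h5 : (2 * ((1 + 80 * Λ) * Y / z₁)) * z₁ ≤
        (2 * (1 + 7 * Λ * F + 119 * Λ + 2 * F) + 2 * ((1 + 80 * Λ) * Y / z₁)) * (P + Q) := by
      gcongr
      · have : 0 ≤ 2 * (1 + 7 * Λ * F + 119 * Λ + 2 * F) := by positivity
        linarith
      · linarith
    have h6 := mul_nonneg hF0 hv1'
    linarith


/-- Height above `y₀` in the scale `R`, measured from the start of the right cap. -/
def capCoord (R a : ℝ → ℝ) (σ y₀ t y : ℝ) : ℝ := σ * (y - y₀) / R t - a t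

lemma hasDerivAt_capCoord (R a : ℝ → ℝ) (σ y₀ t y : ℝ) :
    HasDerivAt (capCoord R a σ y₀ t) (σ / R t) y := by
  have := ((((hasDerivAt_id y).sub_const y₀).const_mul σ).div_const (R t)).sub_const (a t)
  exact this.congr_deriv (by simp)

lemma hasDerivWithinAt_capCoord {R a : ℝ → ℝ} {R' a' σ y₀ t y : ℝ} {s : Set ℝ} (h0 : R t ≠ 0)
    (hR : HasDerivWithinAt R R' s t) (ha : HasDerivWithinAt a a' s t) :
    HasDerivWithinAt (fun t => capCoord R a σ y₀ t y)
      (-(σ * (y - y₀) * R') / R t ^ 2 - a') s t := by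
  have := ((hasDerivWithinAt_const t s (σ * (y - y₀))).div hR h0).sub ha
  simpa using! this

/-- The two-sided cap built from a profile. -/
lemma IsCapProfile.isProfileFamily {ε : ℝ} {V p p' : ℝ → ℝ} (hV : IsCapProfile ε V p p')
    (hε : 0 < ε) (hε' : ε ≤ 1 / 8) {a b y₀ : ℝ} {R R' A A' : ℝ → ℝ} (hab : a < b)
    (hR0 : ∀ t ∈ Icc a b, 0 < R t) (hR : ContDiffOn ℝ ∞ R (Icc a b))
    (hR' : ∀ t ∈ Icc a b, HasDerivWithinAt R (R' t) (Icc a b) t)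
    (hA : ContDiffOn ℝ ∞ A (Icc a b))
    (hA' : ∀ t ∈ Icc a b, HasDerivWithinAt A (A' t) (Icc a b) t)
    (hA2 : ∀ t ∈ Icc a b, 1 / 2 ≤ A t) :
    IsProfileFamily a b R R'
      (fun t y => V (capCoord R A 1 y₀ t y) + V (capCoord R A (-1) y₀ t y))
      (fun t y => (p (capCoord R A 1 y₀ t y) - p (capCoord R A (-1) y₀ t y)) / R t)
      (fun t y => (p' (capCoord R A 1 y₀ t y) + p' (capCoord R A (-1) y₀ t y)) / R t ^ 2)
      (fun t y => p (capCoord R A 1 y₀ t y) * (-((y - y₀) * R' t) / R t ^ 2 - A' t) +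
        p (capCoord R A (-1) y₀ t y) * ((y - y₀) * R' t / R t ^ 2 - A' t)) where
  lt := hab
  pos := hR0
  smooth_radius := hR
  deriv_radius := hR'
  smooth := by
    have h1 : ∀ σ : ℝ, ContDiffOn ℝ ∞ (fun q : ℝ × ℝ => V (capCoord R A σ y₀ q.1 q.2))
        (Icc a b ×ˢ univ) := by
      intro σ
      have hRq : ContDiffOn ℝ ∞ (fun q : ℝ × ℝ => R q.1) (Icc a b ×ˢ univ) :=
        hR.comp contDiffOn_fst fun q hq => hq.1
      have hAq : ContDiffOn ℝ ∞ (fun q : ℝ × ℝ => A q.1) (Icc a b ×ˢ univ) :=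
        hA.comp contDiffOn_fst fun q hq => hq.1
      refine hV.smooth.comp_contDiffOn (ContDiffOn.sub (ContDiffOn.div ?_ hRq fun q hq =>
        (hR0 _ hq.1).ne') hAq)
      fun_prop
    exact (h1 1).add (h1 (-1))
  deriv_one := fun t _ y => by
    refine (((hV.hasDerivAt _).comp y (hasDerivAt_capCoord R A 1 y₀ t y)).add
      ((hV.hasDerivAt _).comp y (hasDerivAt_capCoord R A (-1) y₀ t y))).congr_deriv ?_
    ring
  deriv_two := fun t _ y => by
    refine ((((hV.hasDerivAt_deriv _).comp y (hasDerivAt_capCoord R A 1 y₀ t y)).sub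
      ((hV.hasDerivAt_deriv _).comp y
        (hasDerivAt_capCoord R A (-1) y₀ t y))).div_const (R t)).congr_deriv ?_
    ring
  deriv_time := fun t ht y => by
    have h := hasDerivWithinAt_capCoord (y₀ := y₀) (y := y) (σ := 1) (hR0 t ht).ne' (hR' t ht)
      (hA' t ht)
    have h' := hasDerivWithinAt_capCoord (y₀ := y₀) (y := y) (σ := -1) (hR0 t ht).ne' (hR' t ht)
      (hA' t ht)
    refine (((hV.hasDerivAt _).comp_hasDerivWithinAt t h).add
      ((hV.hasDerivAt _).comp_hasDerivWithinAt t h')).congr_deriv ?_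
    ring
  convex := fun t ht y => div_pos (add_pos (hV.deriv_deriv_pos _) (hV.deriv_deriv_pos _))
    (pow_pos (hR0 t ht) 2)
  -- A vanishing slope forces the two cap coordinates to agree. Both then lie in the flat tail,
  -- where v ≤ 1/4, so v = 1 is impossible.
  regular := fun t ht y hy h0 => by
    have h1 : p (capCoord R A 1 y₀ t y) = p (capCoord R A (-1) y₀ t y) := by
      rw [div_eq_zero_iff] at h0
      exact sub_eq_zero.mp (h0.resolve_right (hR0 t ht).ne')
    have hinj : StrictMono p := strictMono_of_deriv_pos fun s => by
      rw [(hV.hasDerivAt_deriv s).deriv]; exact hV.deriv_deriv_pos s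
    have h2 := hinj.injective h1
    have h3 : capCoord R A 1 y₀ t y ≤ -(1 / 2) := by
      have h4 : capCoord R A 1 y₀ t y + capCoord R A (-1) y₀ t y = -(2 * A t) := by
        simp only [capCoord]; ring
      have := hA2 t ht
      linarith
    have h5 := hV.deriv_le_exp_eighth hε hε' h3
    have h6 := hV.le_deriv (capCoord R A 1 y₀ t y)
    rw [← h2] at hy
    linarith

/-- Since s₁ + s₂ ≤ -1, the smaller coordinate is at most -1/2, hence in the flat tail with slope at
most 1/8; the other case follows by symmetry. The constant c comes before ε, because ε will depend
on the point to be captured while the time step may not. -/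
lemma IsSpeedFunction.exists_cap_barrier (hf : IsSpeedFunction f) (hα : 0 < α)
    (hI : CylindricalDegeneracy f α) :
    ∃ c : ℝ, 0 < c ∧ ∀ ε, 0 < ε → ε ≤ 1 / 8 → ∃ V p p' : ℝ → ℝ, IsCapProfile ε V p p' ∧
      ∀ s₁ s₂, s₁ + s₂ ≤ -1 → V s₁ + V s₂ ≤ 1 →
        (1 - (V s₁ + V s₂) + (p s₁ - p s₂) ^ 2 / 4) ^ ((1 - α) / 2) *
          fHat f (((p s₁ - p s₂) ^ 2 / 4 + (p' s₁ + p' s₂) * (1 - (V s₁ + V s₂)) / 2) /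
            (1 - (V s₁ + V s₂) + (p s₁ - p s₂) ^ 2 / 4)) ^ α ≤
        fHat f 0 ^ α * (1 - (V s₁ + V s₂)) + c * (p s₁ + p s₂) / 2 := by
  obtain ⟨z₁, hz₁, hz, hprof⟩ := hI.exists_isCapProfile
  obtain ⟨c, hc, hineq⟩ := hf.exists_cap_inequality hα hz₁ hz
  refine ⟨c, hc, fun ε hε hε' => ?_⟩
  obtain ⟨V, p, p', hV, hp⟩ := hprof ε hε hε'
  have key : ∀ s₁ s₂, s₂ ≤ s₁ → s₁ + s₂ ≤ -1 → V s₁ + V s₂ ≤ 1 →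
      (1 - (V s₁ + V s₂) + (p s₁ - p s₂) ^ 2 / 4) ^ ((1 - α) / 2) *
          fHat f (((p s₁ - p s₂) ^ 2 / 4 + (p' s₁ + p' s₂) * (1 - (V s₁ + V s₂)) / 2) /
            (1 - (V s₁ + V s₂) + (p s₁ - p s₂) ^ 2 / 4)) ^ α ≤
        fHat f 0 ^ α * (1 - (V s₁ + V s₂)) + c * (p s₁ + p s₂) / 2 := by
    intro s₁ s₂ h21 hs hVs
    have hmono : StrictMono p := strictMono_of_deriv_pos fun s => by
      rw [(hV.hasDerivAt_deriv s).deriv]; exact hV.deriv_deriv_pos s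
    have h1 := hV.pos s₁
    have h2 := hV.pos s₂
    exact hineq _ _ _ _ _ (hV.deriv_pos s₂) (hV.deriv_le_exp_eighth hε hε' (by linarith))
      (hmono.monotone h21) (hV.deriv_le_of_le_one s₁ (by linarith)) (hV.deriv_deriv_pos _)
      (hV.deriv_deriv_pos _) (by linarith) hVs (add_le_add (hV.le_deriv _) (hV.le_deriv _))
      (hV.deriv_deriv_le _) (hV.deriv_deriv_le _) (hp s₁) (hp s₂)
  refine ⟨V, p, p', hV, fun s₁ s₂ hs hVs => ?_⟩
  rcases le_total s₂ s₁ with h | h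
  · exact key s₁ s₂ h hs hVs
  · have := key s₂ s₁ h (by linarith) (by linarith)
    rw [add_comm (V s₁), add_comm (p' s₁), add_comm (p s₁), ← neg_sub (p s₂), neg_sq]
    exact this

/-- Each target point x at time t gets its own cap solid, centred at the height of x. It starts
inside the given cylindrical piece and contains x at time t. -/
lemma IsSpeedFunction.exists_cylinder_step (hf : IsSpeedFunction f) (hα : 0 < α)
    (hI : CylindricalDegeneracy f α) :
    ∃ τ : ℝ, 0 < τ ∧ (1 + α) * fHat f 0 ^ α * τ ≤ 1 / 2 ∧
      ∀ (T : ℝ) (Ω : ℝ → Set (AmbientSpace n)), IsOuterBarrier f α (Ico 0 T) Ω →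
        ∀ (t₀ ρ ℓ : ℝ), 0 ≤ t₀ → 0 < ρ → openCylinder n ρ ℓ ⊆ Ω t₀ →
        ∀ t, t₀ ≤ t → t < T → t - t₀ ≤ τ * ρ ^ (1 + α) →
          openCylinder n (shrinkingRadius α (ρ ^ (1 + α)) ((1 + α) * fHat f 0 ^ α) t₀ t)
            (ℓ - 2 * ρ) ⊆ Ω t := by
  obtain ⟨c, hc, hcap⟩ := hf.exists_cap_barrier hα hI
  have hF0 : 0 ≤ fHat f 0 ^ α := Real.rpow_nonneg hf.fHat_zero_nonneg _
  set k := (1 + α) * fHat f 0 ^ α with hk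
  have hk0 : 0 ≤ k := by positivity
  -- The first bound keeps the half-length A at least 1/2 while it shrinks at rate 2c/Z; the second
  -- keeps R^(1+α) ≥ Z/2.
  set τ := min (1 / (4 * c)) (1 / (2 * (k + 1))) with hτ
  have hτc : c * τ ≤ 1 / 4 := by
    have : c * τ ≤ c * (1 / (4 * c)) := mul_le_mul_of_nonneg_left (min_le_left _ _) hc.le
    refine this.trans_eq ?_
    field_simp
  have hτk : k * τ ≤ 1 / 2 := by
    have : k * τ ≤ k * (1 / (2 * (k + 1))) := mul_le_mul_of_nonneg_left (min_le_right _ _) hk0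
    refine this.trans ?_
    rw [mul_one_div, div_le_div_iff₀ (by positivity) (by positivity)]
    linarith
  refine ⟨τ, lt_min (by positivity) (by positivity), hτk, ?_⟩
  intro T Ω hΩ t₀ ρ ℓ ht₀ hρ hcyl t ht₀t htT htτ x hx
  have hZ0 : 0 < ρ ^ (1 + α) := Real.rpow_pos_of_pos hρ _
  set Z := ρ ^ (1 + α) with hZ
  set R := shrinkingRadius α Z k t₀ with hR
  have hRt₀ : R t₀ = ρ := by
    rw [hR, shrinkingRadius, sub_self, mul_zero, sub_zero, hZ, ← Real.rpow_mul hρ.le,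
      mul_one_div_cancel (by positivity), Real.rpow_one]
  rcases ht₀t.eq_or_lt with rfl | hlt
  · rw [hRt₀] at hx
    exact hcyl ⟨hx.1, by linarith [hx.2.1], by linarith [hx.2.2]⟩
  have hhalf : ∀ s ∈ Icc t₀ t, Z / 2 ≤ Z - k * (s - t₀) := by
    intro s hs
    have h1 : k * (s - t₀) ≤ k * (τ * Z) := mul_le_mul_of_nonneg_left (by linarith [hs.2]) hk0
    have h2 := mul_le_mul_of_nonneg_right hτk hZ0.le
    linarith
  have hpos : ∀ s ∈ Icc t₀ t, 0 < Z - k * (s - t₀) := fun s hs =>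
    (half_pos hZ0).trans_le (hhalf s hs)
  have hRpos : ∀ s ∈ Icc t₀ t, 0 < R s := fun s hs => shrinkingRadius_pos (hpos s hs)
  have hRt := hRpos t ⟨hlt.le, le_rfl⟩
  set A : ℝ → ℝ := fun s => 1 - 2 * c / Z * (s - t₀) with hA
  have hA2 : ∀ s ∈ Icc t₀ t, 1 / 2 ≤ A s := by
    intro s hs
    have h1 : 2 * c / Z * (s - t₀) ≤ 2 * c / Z * (τ * Z) :=
      mul_le_mul_of_nonneg_left (by linarith [hs.2]) (by positivity)
    have h2 : 2 * c / Z * (τ * Z) = 2 * (c * τ) := by field_simp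
    simp only [hA]
    linarith
  have hAd : ∀ s, HasDerivAt A (-(2 * c / Z)) s := by
    intro s
    simpa using! (((hasDerivAt_id s).sub_const t₀).const_mul (2 * c / Z)).const_sub 1
  set y₀ := x (Fin.last n) with hy₀
  have hx1 : radialSq x < R t ^ 2 := hx.1
  set d := 1 - radialSq x / R t ^ 2 with hd
  have hd0 : 0 < d := by
    rw [hd, sub_pos, div_lt_one (by positivity)]
    exact hx1
  -- With ε ≤ d/4 each cap contributes at most exp(-1/(2ε)) ≤ 2ε ≤ d/2 at the height of x, which
  -- leaves x inside the solid.
  obtain ⟨V, p, p', hV, hineq⟩ := hcap (min (1 / 8) (d / 4)) (lt_min (by norm_num) (by positivity))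
    (min_le_left _ _)
  have hε0 : 0 < min (1 / 8) (d / 4) := lt_min (by norm_num) (by positivity)
  have H := hV.isProfileFamily (y₀ := y₀) hε0 (min_le_left _ _) hlt hRpos
    (contDiffOn_shrinkingRadius hpos)
    (fun s hs => (hasDerivAt_shrinkingRadius hα (hpos s hs)).hasDerivWithinAt)
    (A := A) (A' := fun _ => -(2 * c / Z)) (by fun_prop) (fun s _ => (hAd s).hasDerivWithinAt) hA2
  have hmono : StrictMono p := strictMono_of_deriv_pos fun s => by
    rw [(hV.hasDerivAt_deriv s).deriv]; exact hV.deriv_deriv_pos s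
  have hsub := H.isSmoothSubsolution hf (α := α) fun s hs y hy => ?_
  · refine hΩ t₀ t _ hlt (fun u hu => ⟨ht₀.trans hu.1, hu.2.trans_lt htT⟩) hsub (fun z hz => ?_) t
      ⟨hlt.le, le_rfl⟩ ?_
    -- Initially A = 1 and each cap ends before s = 7/8, so the solid reaches at most (15/8)ρ < 2ρ
    -- from the height of x.
    · have hz' : radialSq z / R t₀ ^ 2 + (V (capCoord R A 1 y₀ t₀ (z (Fin.last n))) +
        V (capCoord R A (-1) y₀ t₀ (z (Fin.last n)))) ≤ 1 := hz
      rw [hRt₀] at hz'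
      have h1 := hV.pos (capCoord R A 1 y₀ t₀ (z (Fin.last n)))
      have h2 := hV.pos (capCoord R A (-1) y₀ t₀ (z (Fin.last n)))
      have h0 : 0 ≤ radialSq z / ρ ^ 2 := div_nonneg (radialSq_nonneg z) (sq_nonneg _)
      have h3 := hV.le_of_le_one (capCoord R A 1 y₀ t₀ (z (Fin.last n))) (by linarith)
      have h4 := hV.le_of_le_one (capCoord R A (-1) y₀ t₀ (z (Fin.last n))) (by linarith)
      simp only [capCoord, hRt₀, hA, sub_self, mul_zero, sub_zero] at h3 h4
      rw [sub_le_iff_le_add, div_le_iff₀ hρ] at h3 h4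
      have h5 := hx.2.1
      have h6 := hx.2.2
      refine hcyl ⟨?_, ?_, ?_⟩
      · change radialSq z < ρ ^ 2
        rw [← div_lt_one (by positivity)]
        linarith
      · linarith
      · linarith
    · change radialSq x / R t ^ 2 + (V (capCoord R A 1 y₀ t (x (Fin.last n))) +
        V (capCoord R A (-1) y₀ t (x (Fin.last n)))) ≤ 1
      have h1 : ∀ σ, capCoord R A σ y₀ t (x (Fin.last n)) = -A t := by
        intro σ
        simp [capCoord, hy₀]
      rw [h1, h1]
      have h2 := hV.deriv_le_exp (-A t) (by linarith [hA2 t ⟨hlt.le, le_rfl⟩])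
      have h3 := hV.le_deriv (-A t)
      have h4 : Real.exp (-(1 / (2 * min (1 / 8) (d / 4)))) ≤ d / 2 := by
        have h5 := Real.add_one_le_exp (1 / (2 * min (1 / 8) (d / 4)))
        have h6 : (0 : ℝ) < 1 / (2 * min (1 / 8) (d / 4)) := by positivity
        rw [Real.exp_neg]
        refine (inv_anti₀ h6 (by linarith)).trans ?_
        rw [one_div, inv_inv]
        linarith [min_le_right (1 / 8 : ℝ) (d / 4)]
      linarith
  · have hRs := hRpos s hs
    have hsum : capCoord R A 1 y₀ s y + capCoord R A (-1) y₀ s y ≤ -1 := by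
      have h4 : capCoord R A 1 y₀ s y + capCoord R A (-1) y₀ s y = -(2 * A s) := by
        simp only [capCoord]; ring
      have := hA2 s hs
      linarith
    -- Shrinking R moves the rescaled height outwards, so the term of v_t containing R' has a
    -- favourable sign and may be discarded.
    have hord : 0 ≤ (p (capCoord R A 1 y₀ s y) - p (capCoord R A (-1) y₀ s y)) * (y - y₀) := by
      rcases le_total y₀ y with h | h
      · refine mul_nonneg (sub_nonneg.mpr (hmono.monotone ?_)) (sub_nonneg.mpr h)
        exact sub_le_sub_right (div_le_div_of_nonneg_right (by linarith) hRs.le) _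
      · refine mul_nonneg_of_nonpos_of_nonpos (sub_nonpos.mpr (hmono.monotone ?_))
          (sub_nonpos.mpr h)
        exact sub_le_sub_right (div_le_div_of_nonneg_right (by linarith) hRs.le) _
    have hp1 := hV.deriv_pos (capCoord R A 1 y₀ s y)
    have hp2 := hV.deriv_pos (capCoord R A (-1) y₀ s y)
    have hkey := hineq _ _ hsum hy
    set s₁ := capCoord R A 1 y₀ s y
    set s₂ := capCoord R A (-1) y₀ s y
    have hN : normalSq (R s) (V s₁ + V s₂) ((p s₁ - p s₂) / R s) =
        1 - (V s₁ + V s₂) + (p s₁ - p s₂) ^ 2 / 4 := by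
      rw [normalSq]; field_simp
    have hX : curvatureRatio (R s) (V s₁ + V s₂) ((p s₁ - p s₂) / R s)
        ((p' s₁ + p' s₂) / R s ^ 2) =
        ((p s₁ - p s₂) ^ 2 / 4 + (p' s₁ + p' s₂) * (1 - (V s₁ + V s₂)) / 2) /
            (1 - (V s₁ + V s₂) + (p s₁ - p s₂) ^ 2 / 4) := by
      rw [curvatureRatio, hN]; congr 1; field_simp
    rw [hN, hX]
    refine hkey.trans ?_
    have hRα : 0 < R s ^ α := Real.rpow_pos_of_pos hRs _
    have hRR : R s ^ α * R s = Z - k * (s - t₀) := by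
      rw [← Real.rpow_add_one hRs.ne', add_comm α 1]
      exact shrinkingRadius_rpow hα (hpos s hs).le
    have hRd : R s ^ α * -shrinkingRadiusDeriv α Z k t₀ s = fHat f 0 ^ α := by
      rw [shrinkingRadius_rpow_mul_deriv (hpos s hs), hk]
      field_simp
    have hRd0 : 0 ≤ -shrinkingRadiusDeriv α Z k t₀ s :=
      nonneg_of_mul_nonneg_right (hRd ▸ hF0) hRα
    have e : R s ^ α * (-shrinkingRadiusDeriv α Z k t₀ s * (1 - (V s₁ + V s₂)) +
        R s * (p s₁ * (-((y - y₀) * shrinkingRadiusDeriv α Z k t₀ s) / R s ^ 2 - -(2 * c / Z)) +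
          p s₂ * ((y - y₀) * shrinkingRadiusDeriv α Z k t₀ s / R s ^ 2 - -(2 * c / Z))) / 2) =
        (R s ^ α * -shrinkingRadiusDeriv α Z k t₀ s) * (1 - (V s₁ + V s₂)) +
        (R s ^ α * R s) * (2 * c / Z) * (p s₁ + p s₂) / 2 +
        R s ^ α * R s * ((p s₁ - p s₂) * (y - y₀)) * -shrinkingRadiusDeriv α Z k t₀ s /
          (2 * R s ^ 2) := by
      field_simp
      ring
    rw [e, hRd, hRR]
    have h1 : 0 ≤ (Z - k * (s - t₀)) * ((p s₁ - p s₂) * (y - y₀)) *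
        -shrinkingRadiusDeriv α Z k t₀ s / (2 * R s ^ 2) :=
      div_nonneg (mul_nonneg (mul_nonneg (hpos s hs).le hord) hRd0) (by positivity)
    have h2 : c ≤ (Z - k * (s - t₀)) * (2 * c / Z) := by
      have := mul_le_mul_of_nonneg_right (hhalf s hs) (by positivity : 0 ≤ 2 * c / Z)
      refine le_trans (le_of_eq ?_) this
      field_simp
    have h3 := mul_le_mul_of_nonneg_right h2 (add_pos hp1 hp2).le
    linarith

end InnerEstimates

/-! ### Frontiers and the geometry near the axis. -/

/-- A ray issuing from a point of a bounded set meets the frontier. -/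
lemma exists_add_smul_mem_frontier {E : Type*} [NormedAddCommGroup E] [NormedSpace ℝ E] {S : Set E}
    (hS : Bornology.IsBounded S) {x v : E} (hx : x ∈ S) (hv : v ≠ 0) :
    ∃ s : ℝ, 0 ≤ s ∧ x + s • v ∈ frontier S := by
  set A : Set ℝ := {s | 0 ≤ s ∧ x + s • v ∈ S} with hA
  have hg : Continuous fun s : ℝ => x + s • v := by fun_prop
  have hne : A.Nonempty := ⟨0, le_rfl, by simpa using hx⟩
  have hbdd : BddAbove A := by
    obtain ⟨M, hM⟩ := isBounded_iff_forall_norm_le.mp hS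
    have hv' : 0 < ‖v‖ := norm_pos_iff.mpr hv
    refine ⟨(M + ‖x‖) / ‖v‖, fun s hs => ?_⟩
    rw [le_div_iff₀ hv']
    have h1 := hM _ hs.2
    have h2 : ‖s • v‖ ≤ ‖x + s • v‖ + ‖x‖ := by
      have := norm_sub_le (x + s • v) x
      rwa [add_sub_cancel_left] at this
    rw [norm_smul, Real.norm_of_nonneg hs.1] at h2
    linarith
  have h0 : 0 ≤ sSup A := le_csSup hbdd ⟨le_rfl, by simpa using hx⟩
  refine ⟨sSup A, h0, ?_, fun hint => ?_⟩
  · exact map_mem_closure (f := fun s : ℝ => x + s • v) hg (csSup_mem_closure hne hbdd)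
      fun s hs => hs.2
  · have h1 : ∀ᶠ s in 𝓝[>] sSup A, x + s • v ∈ S :=
      (hg.continuousAt.eventually (mem_interior_iff_mem_nhds.mp hint)).filter_mono
        nhdsWithin_le_nhds
    obtain ⟨s, hs, hs'⟩ := (h1.and self_mem_nhdsWithin).exists
    exact (not_le_of_gt hs') (le_csSup hbdd ⟨h0.trans (le_of_lt hs'), hs⟩)

lemma continuous_last (n : ℕ) : Continuous fun x : AmbientSpace n => x (Fin.last n) := by
  fun_prop

lemma continuous_radialSq (n : ℕ) : Continuous (radialSq (n := n)) := by
  unfold radialSq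
  fun_prop

lemma last_axis {n : ℕ} (y : ℝ) : (y • axisVector n) (Fin.last n) = y := by
  simp [axisVector]

lemma smul_axisVector_mem_axisSegment {n : ℕ} {c d y : ℝ} (hy : y ∈ Icc c d) :
    y • axisVector n ∈ axisSegment n c d :=
  ⟨fun i => by simp [axisVector], by rwa [last_axis]⟩

lemma eq_smul_axisVector {n : ℕ} {c d : ℝ} {x : AmbientSpace n} (hx : x ∈ axisSegment n c d) :
    x = x (Fin.last n) • axisVector n := by
  ext i
  refine Fin.lastCases ?_ (fun j => ?_) i
  · simp [axisVector]
  · rw [hx.1 j]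
    simp [axisVector]

lemma dist_smul_axisVector_le {n : ℕ} {x : AmbientSpace n} {y r δ : ℝ} (hr : 0 ≤ r)
    (hx : radialSq x ≤ r ^ 2) (hδ : |x (Fin.last n) - y| ≤ δ) :
    dist x (y • axisVector n) ≤ r + δ := by
  have hδ0 := (abs_nonneg _).trans hδ
  have h1 : ‖x - y • axisVector n‖ ^ 2 = radialSq x + (x (Fin.last n) - y) ^ 2 := by
    rw [norm_sq_eq_radialSq_add]
    congr 1
    · simp [radialSq, axisVector]
    · simp [axisVector]
  rw [dist_eq_norm]
  refine abs_le_of_sq_le_sq' ?_ (by positivity) |>.2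
  rw [h1]
  have h2 : (x (Fin.last n) - y) ^ 2 ≤ δ ^ 2 := sq_le_sq' (abs_le.mp hδ).1 (abs_le.mp hδ).2
  nlinarith [mul_nonneg hr hδ0]

lemma isClosed_closedCylinder (n : ℕ) (r : ℝ) : IsClosed (closedCylinder n r) :=
  isClosed_le (continuous_radialSq n) continuous_const

lemma interior_closedCylinder_zero (n : ℕ) [NeZero n] : interior (closedCylinder n 0) = ∅ := by
  rw [eq_empty_iff_forall_notMem]
  intro x hx
  set w : AmbientSpace n := EuclideanSpace.single (0 : Fin n).castSucc 1 with hw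
  have hzero : ∀ z ∈ closedCylinder n 0, z (0 : Fin n).castSucc = 0 := by
    intro z hz
    have h1 : ∑ i : Fin n, z i.castSucc ^ 2 ≤ 0 ^ 2 := hz
    have h2 := Finset.single_le_sum (f := fun i : Fin n => z i.castSucc ^ 2)
      (fun i _ => sq_nonneg _) (Finset.mem_univ 0)
    simp only at h2
    exact pow_eq_zero_iff (two_ne_zero) |>.mp (le_antisymm (by linarith) (sq_nonneg _))
  have hg : Continuous fun s : ℝ => x + s • w := by fun_prop
  have h1 : ∀ᶠ s in 𝓝[>] (0 : ℝ), x + s • w ∈ closedCylinder n 0 := by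
    refine (hg.continuousAt (x := 0)).eventually ?_ |>.filter_mono nhdsWithin_le_nhds
    simp only [zero_smul, add_zero]
    exact mem_interior_iff_mem_nhds.mp hx
  obtain ⟨s, hs, hs'⟩ := (h1.and self_mem_nhdsWithin).exists
  have h2 := hzero _ hs
  have h3 := hzero x (interior_subset hx)
  simp only [PiLp.add_apply, PiLp.smul_apply, smul_eq_mul, hw] at h2
  rw [h3] at h2
  have h4 : s = 0 := by simpa using h2
  exact (ne_of_gt hs') h4

lemma openCylinder_mono {n : ℕ} {r r' ℓ ℓ' : ℝ} (hr : 0 ≤ r) (hrr : r ≤ r') (hℓ : ℓ ≤ ℓ') :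
    openCylinder n r ℓ ⊆ openCylinder n r' ℓ' := fun _ hx =>
  ⟨hx.1.trans_le (pow_le_pow_left₀ hr hrr 2), by linarith [hx.2.1], by linarith [hx.2.2]⟩

/-! ### Persistence of cylindrical pieces up to the collapse time. -/

section Persistence

variable {n : ℕ} [NeZero n] {f : (Fin n → ℝ) → ℝ} {α : ℝ}

lemma IsSpeedFunction.exists_persistence_time (hf : IsSpeedFunction f) (hα : 0 < α)
    (hI : CylindricalDegeneracy f α) :
    ∃ τ : ℝ, 0 < τ ∧ (1 + α) * fHat f 0 ^ α * τ < 1 ∧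
      ∀ (L T : ℝ) (Ω : ℝ → Set (AmbientSpace n)), 2 < L → 0 < T →
        IsBarrierSolution f α (Set.Ico 0 T) Ω → Bornology.IsBounded (Ω 0) →
        openCylinder n 1 L ⊆ Ω 0 → Ω 0 ⊆ closedCylinder n 1 →
        ∀ t ∈ Set.Icc 0 τ ∩ Set.Ico 0 T,
          openCylinder n (cylinderRadius f α t) (L - 2) ⊆ Ω t ∧
          Ω t ⊆ closedCylinder n (cylinderRadius f α t) := by
  obtain ⟨τ, hτ, hkτ, hstep⟩ := hf.exists_cylinder_step hα hI
  have hF0 : 0 ≤ fHat f 0 ^ α := Real.rpow_nonneg hf.fHat_zero_nonneg _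
  refine ⟨τ, hτ, by linarith, fun L T Ω _ _ hΩ hb hin hout t ht => ⟨?_, ?_⟩⟩
  · have := hstep T Ω hΩ.1 0 1 L le_rfl one_pos hin t ht.2.1 ht.2.2
      (by rw [Real.one_rpow]; linarith [ht.1.2])
    rwa [Real.one_rpow, mul_one, ← cylinderRadius_eq] at this
  · refine subset_closedCylinder hf hα hΩ.2 hb hout ht.2 ?_
    have : (1 + α) * fHat f 0 ^ α * t ≤ (1 + α) * fHat f 0 ^ α * τ :=
      mul_le_mul_of_nonneg_left ht.1.2 (by positivity)
    linarith

/-- The step is iterated over the times at which the radius equals θ^j. The step lasts as long as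
the radius needs to drop by the factor θ, so the total loss is at most 2∑θ^j = 2/(1 - θ), uniformly
up to collapse. -/
lemma IsSpeedFunction.exists_loss (hf : IsSpeedFunction f) (hα : 0 < α)
    (hI : CylindricalDegeneracy f α) (hF : 0 < fHat f 0) :
    ∃ D : ℝ, 0 < D ∧ ∀ (L T : ℝ) (Ω : ℝ → Set (AmbientSpace n)),
      IsOuterBarrier f α (Set.Ico 0 T) Ω → openCylinder n 1 L ⊆ Ω 0 →
      ∀ t ∈ Ico 0 T, t < collapseTime f α →
        openCylinder n (cylinderRadius f α t) (L - D) ⊆ Ω t := by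
  obtain ⟨τ, hτ, hkτ, hstep⟩ := hf.exists_cylinder_step hα hI
  have hF0 : 0 < fHat f 0 ^ α := Real.rpow_pos_of_pos hF _
  set k := (1 + α) * fHat f 0 ^ α with hk
  have hk0 : 0 < k := by positivity
  have hkτ0 : 0 < k * τ := by positivity
  set Θ := 1 - k * τ with hΘ
  have hΘ0 : 0 < Θ := by linarith
  have hΘ1 : Θ < 1 := by linarith
  set θ := Θ ^ (1 / (1 + α)) with hθ
  have hθ0 : 0 < θ := Real.rpow_pos_of_pos hΘ0 _
  have hθ1 : θ < 1 := Real.rpow_lt_one hΘ0.le hΘ1 (by positivity)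
  have hθpow : ∀ j : ℕ, (θ ^ j) ^ (1 + α) = Θ ^ j := by
    intro j
    rw [hθ, ← Real.rpow_natCast, ← Real.rpow_mul hΘ0.le, ← Real.rpow_mul hΘ0.le,
      ← Real.rpow_natCast]
    congr 1
    field_simp
  refine ⟨2 / (1 - θ), by have : 0 < 1 - θ := by linarith
                          positivity, fun L T Ω hΩ hin t ht htc => ?_⟩
  have key : ∀ j : ℕ, ∀ t ∈ Ico 0 T, Θ ^ j ≤ 1 - k * t →
      openCylinder n (cylinderRadius f α t) (L - 2 * ∑ i ∈ Finset.range j, θ ^ i) ⊆ Ω t := by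
    intro j
    induction j with
    | zero =>
      intro t ht htk
      rw [pow_zero] at htk
      have : t = 0 := le_antisymm (nonpos_of_mul_nonpos_right (by linarith) hk0) ht.1
      subst this
      simpa [cylinderRadius] using hin
    | succ j ih =>
      intro t ht htk
      have hθj : 0 < θ ^ j := by positivity
      have hΘj : 0 < Θ ^ j := by positivity
      have hΘj1 : Θ ^ j ≤ 1 := pow_le_one₀ hΘ0.le hΘ1.le
      have hsum : L - 2 * ∑ i ∈ Finset.range (j + 1), θ ^ i =
          L - 2 * ∑ i ∈ Finset.range j, θ ^ i - 2 * θ ^ j := by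
        rw [Finset.sum_range_succ]; ring
      rw [hsum]
      -- Either the radius at time t is still at least θ^j, or the step is restarted at the time
      -- `t₀` when it equals θ^j.
      rcases le_or_gt (Θ ^ j) (1 - k * t) with h | h
      · refine (openCylinder_mono ?_ le_rfl (by linarith)).trans (ih t ht h)
        exact Real.rpow_nonneg (hΘj.le.trans h) _
      · set t₀ := (1 - Θ ^ j) / k with ht₀
        have hkt₀ : k * t₀ = 1 - Θ ^ j := by rw [ht₀]; field_simp
        have ht₀0 : 0 ≤ t₀ := div_nonneg (by linarith) hk0.le
        have ht₀t : t₀ ≤ t := by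
          rw [ht₀, div_le_iff₀ hk0]
          linarith
        have h1 := ih t₀ ⟨ht₀0, ht₀t.trans_lt ht.2⟩ (by linarith)
        have h2 : cylinderRadius f α t₀ = θ ^ j := by
          rw [cylinderRadius, ← hk, hkt₀, sub_sub_cancel, ← hθpow, ← Real.rpow_mul hθj.le,
            mul_one_div_cancel (by positivity), Real.rpow_one]
        rw [h2] at h1
        have h3 := hstep T Ω hΩ t₀ (θ ^ j) _ ht₀0 hθj h1 t ht₀t ht.2 (by
          rw [hθpow, ← mul_le_mul_iff_right₀ hk0]
          have : Θ ^ (j + 1) = Θ ^ j * (1 - k * τ) := pow_succ _ _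
          linarith)
        rw [hθpow] at h3
        have h4 : shrinkingRadius α (Θ ^ j) k t₀ t = cylinderRadius f α t := by
          rw [shrinkingRadius, cylinderRadius, ← hk]
          congr 1
          linarith
        rwa [h4] at h3
  have hkt : 0 < 1 - k * t := by
    rw [collapseTime, ← hk, lt_div_iff₀ hk0] at htc
    linarith
  obtain ⟨j, hj⟩ := exists_pow_lt_of_lt_one hkt hΘ1
  refine (openCylinder_mono (Real.rpow_nonneg hkt.le _) le_rfl ?_).trans (key j t ht hj.le)
  have hgeo : ∑ i ∈ Finset.range j, θ ^ i ≤ 1 / (1 - θ) := by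
    have h1 := (summable_geometric_of_lt_one hθ0.le hθ1).sum_le_tsum (Finset.range j)
      fun i _ => pow_nonneg hθ0.le i
    rwa [tsum_geometric_of_lt_one hθ0.le hθ1, inv_eq_one_div] at h1
  have : 2 / (1 - θ) = 2 * (1 / (1 - θ)) := by ring
  linarith

lemma cylinderRadius_pos (hk : 0 < (1 + α) * fHat f 0 ^ α) {t : ℝ} (ht : t < collapseTime f α) :
    0 < cylinderRadius f α t := by
  rw [collapseTime, lt_div_iff₀ hk] at ht
  exact Real.rpow_pos_of_pos (by linarith) _

lemma cylinderRadius_collapseTime (hα : 0 < α) (hk : 0 < (1 + α) * fHat f 0 ^ α) :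
    cylinderRadius f α (collapseTime f α) = 0 := by
  rw [cylinderRadius, collapseTime, mul_one_div_cancel hk.ne', sub_self,
    Real.zero_rpow (by positivity)]

lemma continuous_cylinderRadius (hα : 0 < α) : Continuous (cylinderRadius f α) := by
  unfold cylinderRadius
  exact (continuous_const.sub (continuous_const.mul continuous_id)).rpow_const
    fun _ => Or.inr (by positivity)

end Persistence

/-- A thin bounded convex set is close, in Hausdorff distance, to its axial shadow. -/
lemma hausdorffEDist_frontier_le {n : ℕ} [NeZero n] {S : Set (AmbientSpace n)}
    (hS : Bornology.IsBounded S) (hconv : Convex ℝ S) {r c d g η : ℝ} (hr : 0 ≤ r) (hg : 0 ≤ g)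
    (hη : 0 ≤ η) (hηcd : 2 * η ≤ d - c) (hcyl : S ⊆ closedCylinder n r)
    (hlow : ∀ x ∈ S, c - g ≤ x (Fin.last n)) (hupp : ∀ x ∈ S, x (Fin.last n) ≤ d + g)
    (hc : ∃ x ∈ S, x (Fin.last n) ≤ c + η) (hd : ∃ x ∈ S, d - η ≤ x (Fin.last n)) :
    Metric.hausdorffEDist (frontier S) (axisSegment n c d) ≤ ENNReal.ofReal (r + g + η) := by
  have hcyl' : closure S ⊆ closedCylinder n r :=
    closure_minimal hcyl (isClosed_closedCylinder n r)
  have hlow' : ∀ x ∈ closure S, c - g ≤ x (Fin.last n) := fun x hx =>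
    closure_minimal hlow (isClosed_le continuous_const (continuous_last n)) hx
  have hupp' : ∀ x ∈ closure S, x (Fin.last n) ≤ d + g := fun x hx =>
    closure_minimal hupp (isClosed_le (continuous_last n) continuous_const) hx
  refine Metric.hausdorffEDist_le_of_mem_edist (fun x hx => ?_) (fun x hx => ?_)
  · have hx' := frontier_subset_closure hx
    have h1 := hlow' x hx'
    have h2 := hupp' x hx'
    refine ⟨max c (min (x (Fin.last n)) d) • axisVector n,
      smul_axisVector_mem_axisSegment ⟨le_max_left _ _, max_le (by linarith) (min_le_right _ _)⟩, ?_⟩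
    rw [edist_dist]
    refine ENNReal.ofReal_le_ofReal ((dist_smul_axisVector_le hr (hcyl' hx')
      (abs_le.mpr ⟨?_, ?_⟩ : _ ≤ g)).trans (by linarith))
    · have : max c (min (x (Fin.last n)) d) ≤ x (Fin.last n) + g :=
        max_le (by linarith) ((min_le_left _ _).trans (by linarith))
      linarith
    · have : x (Fin.last n) - g ≤ max c (min (x (Fin.last n)) d) :=
        le_max_of_le_right (le_min (by linarith) (by linarith))
      linarith
  -- Connectedness gives a point of S at nearly the required height; a ray from it perpendicular to
  -- the axis meets the frontier at the same height, still within distance r of the axis.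
  · obtain ⟨a, ha, hac⟩ := hc
    obtain ⟨b, hb, hbd⟩ := hd
    set y := x (Fin.last n) with hy
    have hab : a (Fin.last n) ≤ b (Fin.last n) := by linarith
    obtain ⟨q, hq, hqy⟩ := hconv.isPreconnected.intermediate_value ha hb
      (continuous_last n).continuousOn
      (show max (a (Fin.last n)) (min y (b (Fin.last n))) ∈ _ from
        ⟨le_max_left _ _, max_le hab (min_le_right _ _)⟩)
    have hw0 : (EuclideanSpace.single (0 : Fin n).castSucc 1 : AmbientSpace n) ≠ 0 := by simp
    obtain ⟨s, -, hs⟩ := exists_add_smul_mem_frontier hS hq hw0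
    have hlast : (q + s • (EuclideanSpace.single (0 : Fin n).castSucc 1 : AmbientSpace n))
        (Fin.last n) = max (a (Fin.last n)) (min y (b (Fin.last n))) := by
      have h0 : Fin.last n ≠ (0 : Fin n).castSucc := (Fin.castSucc_lt_last _).ne'
      rw [← hqy, PiLp.add_apply, PiLp.smul_apply, PiLp.single_apply, if_neg h0]
      simp
    refine ⟨_, hs, ?_⟩
    rw [eq_smul_axisVector hx, ← hy, edist_comm, edist_dist]
    refine ENNReal.ofReal_le_ofReal ((dist_smul_axisVector_le hr
      (hcyl' (frontier_subset_closure hs)) (abs_le.mpr ⟨?_, ?_⟩ : _ ≤ η)).trans (by linarith))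
    · rw [hlast]
      have : y - η ≤ max (a (Fin.last n)) (min y (b (Fin.last n))) :=
        le_max_of_le_right (le_min (by linarith) (by linarith [hx.2.2]))
      linarith
    · rw [hlast]
      have : max (a (Fin.last n)) (min y (b (Fin.last n))) ≤ y + η :=
        max_le (by linarith [hx.2.1]) ((min_le_left _ _).trans (by linarith))
      linarith

/-! ### Collapse onto a segment. -/

section Collapse

variable {n : ℕ} [NeZero n] {f : (Fin n → ℝ) → ℝ} {α : ℝ}

/-- The axial extent of a barrier solution in the direction `σ = ±1` is monotone and converges. -/
lemma exists_axial_limit (hf : IsSpeedFunction f) (hα : 0 < α) {T t₁ σ m : ℝ}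
    {Ω : ℝ → Set (AmbientSpace n)} (hΩ : IsInnerBarrier f α (Ico 0 T) Ω)
    (hb : ∀ t ∈ Ico 0 T, Bornology.IsBounded (Ω t)) (hσ : σ ^ 2 = 1) (ht₁ : 0 < t₁) (htT : t₁ ≤ T)
    (hm : ∀ t ∈ Ico 0 t₁, ∃ x ∈ Ω t, m ≤ σ * x (Fin.last n)) :
    ∃ E, m ≤ E ∧ (∀ t ∈ Ico 0 t₁, ∀ η, 0 < η → ∃ x ∈ Ω t, E - η ≤ σ * x (Fin.last n)) ∧
      ∀ η, 0 < η → ∀ᶠ t in 𝓝[<] t₁, ∀ x ∈ Ω t, σ * x (Fin.last n) ≤ E + η := by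
  set e : ℝ → ℝ := fun t => sSup ((fun x : AmbientSpace n => σ * x (Fin.last n)) '' Ω t) with he
  have hσabs : |σ| = 1 := by
    rw [← sq_abs] at hσ
    nlinarith [abs_nonneg σ]
  have hbdd : ∀ t ∈ Ico 0 t₁,
      BddAbove ((fun x : AmbientSpace n => σ * x (Fin.last n)) '' Ω t) := by
    intro t ht
    obtain ⟨M, hM⟩ := isBounded_iff_forall_norm_le.mp (hb t ⟨ht.1, ht.2.trans_le htT⟩)
    refine ⟨M, ?_⟩
    rintro _ ⟨x, hx, rfl⟩
    refine (le_abs_self _).trans ?_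
    rw [abs_mul, hσabs, one_mul]
    exact (abs_last_le_norm x).trans (hM x hx)
  have hme : ∀ t ∈ Ico 0 t₁, m ≤ e t := by
    intro t ht
    obtain ⟨x, hx, hmx⟩ := hm t ht
    exact hmx.trans (le_csSup (hbdd t ht) ⟨x, hx, rfl⟩)
  have hne : (e '' Ico 0 t₁).Nonempty := ⟨_, 0, ⟨le_rfl, ht₁⟩, rfl⟩
  have hbb : BddBelow (e '' Ico 0 t₁) := ⟨m, by rintro _ ⟨t, ht, rfl⟩; exact hme t ht⟩
  -- Half-spaces persist, so the extent e is nonincreasing and its infimum is its limit at t₁.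
  refine ⟨sInf (e '' Ico 0 t₁), le_csInf hne (by rintro _ ⟨t, ht, rfl⟩; exact hme t ht),
    fun t ht η hη => ?_, fun η hη => ?_⟩
  · have h1 : sInf (e '' Ico 0 t₁) - η < e t := by
      have := csInf_le hbb ⟨t, ht, rfl⟩
      linarith
    obtain ⟨x, hx, -⟩ := hm t ht
    obtain ⟨_, ⟨z, hz, rfl⟩, hlt⟩ := exists_lt_of_lt_csSup
      (Set.Nonempty.image (fun x : AmbientSpace n => σ * x (Fin.last n)) ⟨x, hx⟩) h1
    exact ⟨z, hz, hlt.le⟩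
  · obtain ⟨_, ⟨s, hs, rfl⟩, hlt⟩ := exists_lt_of_csInf_lt hne (lt_add_of_pos_right _ hη)
    filter_upwards [Ioo_mem_nhdsLT hs.2] with t ht x hx
    refine (axial_le_of_isInnerBarrier hf hα hΩ hs.1 ht.1.le (ht.2.trans_le htT)
      (hb s ⟨hs.1, hs.2.trans_le htT⟩) hσ (fun z hz => ?_) x hx).trans hlt.le
    exact le_csSup (hbdd s hs) ⟨z, hz, rfl⟩

lemma IsSpeedFunction.exists_collapse_constant (hf : IsSpeedFunction f) (hα : 0 < α)
    (hI : CylindricalDegeneracy f α) (hF : 0 < fHat f 0) :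
    ∃ C : ℝ, 0 < C ∧
      ∀ (L T : ℝ) (Ω : ℝ → Set (AmbientSpace n)), C < L → 0 < T →
        IsBarrierSolution f α (Set.Ico 0 T) Ω →
        Bornology.IsBounded (Ω 0) →
        openCylinder n 1 L ⊆ Ω 0 → Ω 0 ⊆ closedCylinder n 1 →
        (∀ t ∈ Set.Ico 0 T, t < collapseTime f α →
          axisSegment n (-(L - C)) (L - C) ⊆ Ω t ∧
          Ω t ⊆ closedCylinder n (cylinderRadius f α t)) ∧
        ((∀ t ∈ Set.Ico 0 T, (interior (Ω t)).Nonempty) → T ≤ collapseTime f α) ∧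
        (T ≤ collapseTime f α → ∀ p : AmbientSpace n,
          ¬ ∀ ε : ℝ, 0 < ε → ∀ᶠ t in 𝓝[<] T, frontier (Ω t) ⊆ Metric.ball p ε) ∧
        (collapseTime f α ≤ T → (∀ t ∈ Set.Ico 0 (collapseTime f α), Convex ℝ (Ω t)) →
          ∃ c d : ℝ, c ≤ -(L - C) ∧ L - C ≤ d ∧
            Tendsto (fun t => Metric.hausdorffEDist (frontier (Ω t)) (axisSegment n c d))
              (𝓝[<] (collapseTime f α)) (𝓝 0)) := by
  obtain ⟨D, hD, hloss⟩ := hf.exists_loss hα hI hF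
  have hk : 0 < (1 + α) * fHat f 0 ^ α := mul_pos (by linarith) (Real.rpow_pos_of_pos hF _)
  have htc : 0 < collapseTime f α := one_div_pos.mpr hk
  -- The extra 1 places the closed segment inside the open cylinder of half-length L - D.
  refine ⟨D + 1, by linarith, fun L T Ω hL hT hΩ hb hin hout => ?_⟩
  have hm : 0 < L - (D + 1) := by linarith
  have hbt : ∀ t ∈ Ico 0 T, Bornology.IsBounded (Ω t) := fun t ht =>
    isBounded_of_isInnerBarrier hf hα hΩ.2 hb ht
  have hcyl : ∀ t ∈ Ico 0 T, t ≤ collapseTime f α →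
      Ω t ⊆ closedCylinder n (cylinderRadius f α t) := by
    intro t ht htc
    refine subset_closedCylinder hf hα hΩ.2 hb hout ht ?_
    rwa [collapseTime, le_div_iff₀' hk] at htc
  have hseg : ∀ t ∈ Ico 0 T, t < collapseTime f α →
      axisSegment n (-(L - (D + 1))) (L - (D + 1)) ⊆ Ω t := by
    intro t ht htc x hx
    refine hloss L T Ω hΩ.1 hin t ht htc ⟨?_, ?_, ?_⟩
    · have := cylinderRadius_pos hk htc
      simp only [hx.1]
      simpa using pow_pos this 2
    · linarith [hx.2.1]
    · linarith [hx.2.2]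
  have hpt : ∀ t ∈ Ico 0 T, t < collapseTime f α → ∀ y ∈ Icc (-(L - (D + 1))) (L - (D + 1)),
      y • axisVector n ∈ Ω t := fun t ht htc y hy =>
    hseg t ht htc (smul_axisVector_mem_axisSegment hy)
  refine ⟨fun t ht htc => ⟨hseg t ht htc, hcyl t ht htc.le⟩, fun hint => ?_,
    fun hTc p hp => ?_, fun hTc hconv => ?_⟩
  -- At the collapse time the outer cylinder has radius 0, so the slice lies in the axis and has
  -- empty interior.
  · by_contra! h
    have h1 := hcyl _ ⟨htc.le, h⟩ le_rfl
    rw [cylinderRadius_collapseTime hα hk] at h1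
    have h2 := (hint _ ⟨htc.le, h⟩).mono (interior_mono h1)
    rw [interior_closedCylinder_zero] at h2
    exact not_nonempty_empty h2
  -- Axial rays leaving the two ends of the surviving segment meet the frontier at points at least
  -- 2(L - (D + 1)) apart, too far for one ball of radius L - (D + 1).
  · obtain ⟨t, ht, ht'⟩ := ((hp _ hm).and (Ioo_mem_nhdsLT hT)).exists
    have htT : t ∈ Ico 0 T := ⟨ht'.1.le, ht'.2⟩
    have htc' := ht'.2.trans_le hTc
    have hv : axisVector n ≠ 0 := by
      rw [← norm_ne_zero_iff, norm_axisVector]; exact one_ne_zero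
    obtain ⟨s₁, hs₁, h₁⟩ := exists_add_smul_mem_frontier (hbt t htT)
      (hpt t htT htc' (L - (D + 1)) ⟨by linarith, le_rfl⟩) hv
    obtain ⟨s₂, hs₂, h₂⟩ := exists_add_smul_mem_frontier (hbt t htT)
      (hpt t htT htc' (-(L - (D + 1))) ⟨le_rfl, by linarith⟩) (neg_ne_zero.mpr hv)
    have hd := dist_triangle_right ((L - (D + 1)) • axisVector n + s₁ • axisVector n)
      (-(L - (D + 1)) • axisVector n + s₂ • -axisVector n) p
    have hd1 := Metric.mem_ball.mp (ht h₁)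
    have hd2 := Metric.mem_ball.mp (ht h₂)
    have heq : (L - (D + 1)) • axisVector n + s₁ • axisVector n -
        (-(L - (D + 1)) • axisVector n + s₂ • -axisVector n) =
        (2 * (L - (D + 1)) + s₁ + s₂) • axisVector n := by module
    rw [dist_eq_norm _ (_ + s₂ • _), heq, norm_smul, norm_axisVector, mul_one] at hd
    have := le_abs_self (2 * (L - (D + 1)) + s₁ + s₂)
    rw [← Real.norm_eq_abs] at this
    linarith
  · have hlim := fun (σ : ℝ) (hσ : σ ^ 2 = 1) (hσ1 : |σ| ≤ 1) =>
      exists_axial_limit hf hα (m := L - (D + 1)) hΩ.2 hbt hσ htc hTc fun t ht =>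
        ⟨(σ * (L - (D + 1))) • axisVector n, hpt t ⟨ht.1, ht.2.trans_le hTc⟩ ht.2 _
          ⟨by nlinarith [(abs_le.mp hσ1).1], by nlinarith [(abs_le.mp hσ1).2]⟩, by
          rw [last_axis, ← mul_assoc, ← sq, hσ, one_mul]⟩
    obtain ⟨d, hd, hd1, hd2⟩ := hlim 1 (by norm_num) (by norm_num)
    obtain ⟨c, hc, hc1, hc2⟩ := hlim (-1) (by norm_num) (by norm_num)
    refine ⟨-c, d, by linarith, hd, ENNReal.tendsto_nhds_zero.mpr fun ε hε => ?_⟩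
    obtain ⟨δ, hδ, hδε⟩ : ∃ δ : ℝ, 0 < δ ∧ ENNReal.ofReal δ ≤ ε := by
      rcases eq_or_ne ε ⊤ with rfl | h
      · exact ⟨1, one_pos, le_top⟩
      · exact ⟨ε.toReal, ENNReal.toReal_pos hε.ne' h, (ENNReal.ofReal_toReal h).le⟩
    have hrad : ∀ᶠ t in 𝓝[<] (collapseTime f α), cylinderRadius f α t < δ / 3 := by
      have h := ((continuous_cylinderRadius (f := f) hα).tendsto (collapseTime f α)).mono_left
        (nhdsWithin_le_nhds (s := Iio (collapseTime f α)))
      rw [cylinderRadius_collapseTime hα hk] at h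
      exact h.eventually (gt_mem_nhds (by positivity))
    -- The second entry guarantees 2η ≤ d - c, which orders the two near-extremal heights used in
    -- the Hausdorff estimate.
    have hη : 0 < min (δ / 3) (L - (D + 1)) := lt_min (by positivity) hm
    filter_upwards [hrad, hd2 (δ / 3) (by positivity), hc2 (δ / 3) (by positivity),
      Ioo_mem_nhdsLT htc] with t ht1 ht2 ht3 ht
    have htI : t ∈ Ico 0 (collapseTime f α) := ⟨ht.1.le, ht.2⟩
    have htT : t ∈ Ico 0 T := ⟨ht.1.le, ht.2.trans_le hTc⟩
    obtain ⟨a, ha, haη⟩ := hc1 t htI _ hη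
    obtain ⟨b, hb, hbη⟩ := hd1 t htI _ hη
    refine (hausdorffEDist_frontier_le (hbt t htT) (hconv t htI) (g := δ / 3)
      (η := min (δ / 3) (L - (D + 1))) (cylinderRadius_pos hk ht.2).le (by positivity) hη.le
      (by linarith [min_le_right (δ / 3) (L - (D + 1))]) (hcyl t htT ht.2.le)
      (fun x hx => by linarith [ht3 x hx]) (fun x hx => by linarith [ht2 x hx])
      ⟨a, ha, by linarith⟩ ⟨b, hb, by linarith⟩).trans
      ((ENNReal.ofReal_le_ofReal ?_).trans hδε)
    linarith [min_le_left (δ / 3) (L - (D + 1))]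

end Collapse

/-! ### The example |A|^α. -/

section SecondFormNorm

variable {n : ℕ}

lemma hasFDerivAt_sum_sq (κ : Fin n → ℝ) :
    HasFDerivAt (fun κ : Fin n → ℝ => ∑ i, κ i ^ 2)
      (∑ i, (2 * κ i) • (ContinuousLinearMap.proj i : (Fin n → ℝ) →L[ℝ] ℝ)) κ := by
  refine HasFDerivAt.fun_sum fun i _ => ?_
  have := (hasFDerivAt_apply (𝕜 := ℝ) i κ).pow 2
  simpa using! this

lemma continuous_secondFormNorm (n : ℕ) : Continuous (secondFormNorm n) := by
  unfold secondFormNorm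
  fun_prop

variable [NeZero n]

lemma sum_sq_pos {κ : Fin n → ℝ} (hκ : κ ∈ positiveCone n) : 0 < ∑ i, κ i ^ 2 :=
  Finset.sum_pos (fun i _ => pow_pos (hκ i) 2) ⟨0, Finset.mem_univ _⟩

lemma isSpeedFunction_secondFormNorm : IsSpeedFunction (secondFormNorm n) where
  smooth := by
    refine ContDiffOn.sqrt ?_ fun κ hκ => (sum_sq_pos hκ).ne'
    fun_prop
  symmetric σ κ _ := by
    simp only [secondFormNorm, Function.comp_apply]
    rw [Equiv.sum_comp σ fun i => κ i ^ 2]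
  increasing κ hκ i := by
    have h : HasFDerivAt (secondFormNorm n) _ κ :=
      (hasFDerivAt_sum_sq κ).sqrt (sum_sq_pos hκ).ne'
    rw [h.fderiv]
    have h1 : (∑ j, (2 * κ j) • (ContinuousLinearMap.proj j : (Fin n → ℝ) →L[ℝ] ℝ))
        (Pi.single i 1) = 2 * κ i := by
      simp [Pi.single_apply]
    rw [smul_apply, h1, smul_eq_mul]
    have := sum_sq_pos hκ
    have := hκ i
    positivity
  homogeneous c hc κ _ := by
    simp only [secondFormNorm, Pi.smul_apply, smul_eq_mul, mul_pow]
    rw [← Finset.mul_sum, Real.sqrt_mul (sq_nonneg c), Real.sqrt_sq hc.le]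
  pos κ hκ := Real.sqrt_pos.mpr (sum_sq_pos hκ)

lemma fHat_secondFormNorm {x : ℝ} (hx : 0 ≤ x) :
    fHat (secondFormNorm n) x = √(((n - 1 : ℕ) : ℝ) + x ^ 2) := by
  rw [fHat_eq_of_continuousAt hx (continuous_secondFormNorm n).continuousAt, secondFormNorm]
  congr 1
  have h1 : ∀ i, Function.update (fun _ => (1 : ℝ)) (0 : Fin n) x i ^ 2 =
      Function.update (fun _ => (1 : ℝ)) (0 : Fin n) (x ^ 2) i := by
    intro i
    by_cases hi : i = 0
    · subst hi; simp
    · simp [hi]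
  simp only [h1]
  rw [Finset.sum_update_of_mem (Finset.mem_univ _)]
  simp [Finset.card_sdiff, add_comm]

lemma fHat_secondFormNorm_zero_pos (hn : 2 ≤ n) : 0 < fHat (secondFormNorm n) 0 := by
  rw [fHat_secondFormNorm le_rfl]
  have : (0 : ℝ) < ((n - 1 : ℕ) : ℝ) := by exact_mod_cast (by omega : 0 < n - 1)
  positivity

/-- Here f̂(x)^α = (n - 1 + x²)^(α/2) depends on x through x² and has positive base at 0, so its
increment is O(x²). -/
lemma exists_gFun_secondFormNorm_le (hn : 2 ≤ n) (α : ℝ) :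
    ∃ K : ℝ, 0 < K ∧ ∀ x, 0 ≤ x → x ≤ 1 → gFun (secondFormNorm n) α x ≤ K * x ^ 2 := by
  obtain ⟨Λ, hΛ, hpow⟩ := exists_rpow_le_one_add (α / 2)
  set b : ℝ := ((n - 1 : ℕ) : ℝ) with hb
  have hb1 : 1 ≤ b := by
    rw [hb]
    exact_mod_cast (by omega : 1 ≤ n - 1)
  have hb0 : 0 < b := by linarith
  have hbp : 0 < b ^ (α / 2) := Real.rpow_pos_of_pos hb0 _
  refine ⟨b ^ (α / 2) * Λ, by positivity, fun x hx hx1 => ?_⟩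
  rw [gFun, fHat_secondFormNorm hx, fHat_secondFormNorm le_rfl, ← hb, Real.sqrt_eq_rpow,
    Real.sqrt_eq_rpow, ← Real.rpow_mul (by positivity), ← Real.rpow_mul (by positivity),
    one_div_mul_eq_div]
  have hx2 : x ^ 2 ≤ 1 := pow_le_one₀ hx hx1
  have hdiv : x ^ 2 / b ≤ x ^ 2 := div_le_self (sq_nonneg x) hb1
  have hdiv0 : 0 ≤ x ^ 2 / b := by positivity
  have h1 : b + x ^ 2 = b * (1 + x ^ 2 / b) := by field_simp
  have h2 := hpow (1 + x ^ 2 / b) ⟨by linarith, by linarith⟩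
  rw [add_sub_cancel_left, abs_of_nonneg hdiv0] at h2
  have h3 := mul_le_mul_of_nonneg_left hdiv hΛ.le
  rw [h1, Real.mul_rpow hb0.le (by linarith)]
  have h4 := mul_le_mul_of_nonneg_left (h2.trans (add_le_add_right h3 1)) hbp.le
  have h5 : b + 0 ^ 2 = b := by ring
  rw [h5]
  linarith

/-- From g(x) ≤ Kx² on [0, 1] follows g⁻¹(z) ≥ min(1, √(z/K)), so 1/g⁻¹ is dominated by 1 + √K
z^(-1/2). -/
lemma cylindricalDegeneracy_secondFormNorm (hn : 2 ≤ n) (α : ℝ) :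
    CylindricalDegeneracy (secondFormNorm n) α := by
  obtain ⟨K, hK, hle⟩ := exists_gFun_secondFormNorm_le hn α
  have hint : IntegrableOn (fun z : ℝ => 1 + √K * z ^ (-(1 / 2) : ℝ)) (Ioo 0 1) := by
    refine Integrable.add (integrable_const _) (Integrable.const_mul ?_ _)
    exact (intervalIntegral.integrableOn_Ioo_rpow_iff one_pos).mpr (by norm_num)
  refine lt_of_le_of_lt (setLIntegral_mono' measurableSet_Ioo fun z hz => ?_)
    hint.lintegral_lt_top
  have hzK : 0 < √(z / K) := Real.sqrt_pos.mpr (div_pos hz.1 hK)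
  have hm0 : 0 < min 1 √(z / K) := lt_min one_pos hzK
  have hm : ENNReal.ofReal (min 1 √(z / K)) ≤ gInv (secondFormNorm n) α z := by
    refine le_iInf₂ fun x hx => ENNReal.ofReal_le_ofReal ?_
    rcases le_total x 1 with h | h
    · refine (min_le_right _ _).trans ?_
      rw [Real.sqrt_le_left hx.1, div_le_iff₀ hK, mul_comm]
      exact hx.2.trans (hle x hx.1 h)
    · exact (min_le_left _ _).trans h
  refine (ENNReal.inv_le_inv.mpr hm).trans ?_
  rw [← ENNReal.ofReal_inv_of_pos hm0]
  refine ENNReal.ofReal_le_ofReal ?_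
  have h1 : √K * z ^ (-(1 / 2) : ℝ) = (√(z / K))⁻¹ := by
    rw [Real.rpow_neg hz.1.le, ← Real.sqrt_eq_rpow, Real.sqrt_div hz.1.le, inv_div, div_eq_mul_inv]
  rw [h1]
  rcases min_choice 1 √(z / K) with h | h <;> rw [h]
  · rw [inv_one]
    linarith [inv_pos.mpr hzK]
  · linarith

end SecondFormNorm

end

theorem theorem19 (n : ℕ) [NeZero n] (α : ℝ) (hα : 0 < α) :
    (∀ f : (Fin n → ℝ) → ℝ, IsSpeedFunction f → CylindricalDegeneracy f α →
      -- a slightly shorter cylindrical piece persists for a short time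
      (∃ τ : ℝ, 0 < τ ∧ (1 + α) * fHat f 0 ^ α * τ < 1 ∧
        ∀ (L T : ℝ) (Ω : ℝ → Set (AmbientSpace n)), 2 < L → 0 < T →
          IsBarrierSolution f α (Set.Ico 0 T) Ω →
          Bornology.IsBounded (Ω 0) →
          openCylinder n 1 L ⊆ Ω 0 → Ω 0 ⊆ closedCylinder n 1 →
          ∀ t ∈ Set.Icc 0 τ ∩ Set.Ico 0 T,
            openCylinder n (cylinderRadius f α t) (L - 2) ⊆ Ω t ∧
            Ω t ⊆ closedCylinder n (cylinderRadius f α t)) ∧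
      -- if the cylinder shrinks, long hypersurfaces collapse onto a segment, not to a point
      (0 < fHat f 0 →
        ∃ C : ℝ, 0 < C ∧
        ∀ (L T : ℝ) (Ω : ℝ → Set (AmbientSpace n)), C < L → 0 < T →
          IsBarrierSolution f α (Set.Ico 0 T) Ω →
          Bornology.IsBounded (Ω 0) →
          openCylinder n 1 L ⊆ Ω 0 → Ω 0 ⊆ closedCylinder n 1 →
          (∀ t ∈ Set.Ico 0 T, t < collapseTime f α →
            axisSegment n (-(L - C)) (L - C) ⊆ Ω t ∧
            Ω t ⊆ closedCylinder n (cylinderRadius f α t)) ∧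
          ((∀ t ∈ Set.Ico 0 T, (interior (Ω t)).Nonempty) → T ≤ collapseTime f α) ∧
          (T ≤ collapseTime f α → ∀ p : AmbientSpace n,
            ¬ ∀ ε : ℝ, 0 < ε → ∀ᶠ t in 𝓝[<] T, frontier (Ω t) ⊆ Metric.ball p ε) ∧
          (collapseTime f α ≤ T → (∀ t ∈ Set.Ico 0 (collapseTime f α), Convex ℝ (Ω t)) →
            ∃ c d : ℝ, c ≤ -(L - C) ∧ L - C ≤ d ∧
              Tendsto (fun t => Metric.hausdorffEDist (frontier (Ω t)) (axisSegment n c d))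
                (𝓝[<] (collapseTime f α)) (𝓝 0)))) ∧
    -- the flow with speed `|A|^α` is an example
    (2 ≤ n → IsSpeedFunction (secondFormNorm n) ∧ CylindricalDegeneracy (secondFormNorm n) α ∧
      0 < fHat (secondFormNorm n) 0) := by
  refine ⟨fun f hf hI => ⟨hf.exists_persistence_time hα hI, hf.exists_collapse_constant hα hI⟩,
    fun hn => ⟨isSpeedFunction_secondFormNorm, cylindricalDegeneracy_secondFormNorm hn α,
      fHat_secondFormNorm_zero_pos hn⟩⟩
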